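/- Let $E$ be a hypergeometric equation on $\mathbb P^1_z$, i.e. a Fuchsian equation $u''+fu'+gu=0$ on $\mathbb P^1$ with no singular points outside $\{0,1,\infty\}$ (a Riemann equation with arbitrary complex exponents at $0,1,\infty$). For a point $t$, the order of the local monodromy at $t$ is the order in $\mathrm{PGL}(2,\mathbb C)$ of the monodromy of the equation around $t$, an element of $\{1,2,3,\dots\}\cup\{\infty\}$. Let $p_0,p_1,p_\infty$ be the orders of the local monodromies of $E$ at $0,1,\infty$, with $p_\infty\ge p_0$, $p_\infty\ge p_1$, and suppose that $E$ is hyperbolic: $\frac1{p_0}+\frac1{p_1}+\frac1{p_\infty}<1$ (where $\frac1\infty=0$). Let $\phi:\mathbb P^1_x\to\mathbb P^1_z$ be a ramified covering (a non-constant rational map) of degree $d$ and $E'=\phi^*E$ the pulled-back equation. Call a point $x\in\mathbb P^1$ a non-apparent singularity of $E'$ if the local monodromy of $E'$ at $x$ is non-trivial in $\mathrm{PGL}(2,\mathbb C)$, and an apparent singularity if that local monodromy is trivial but the projective structure induced by $E'$ is singular at $x$ (i.e. if $E'$ reads $\frac{d^2v}{ds^2}+F\frac{dv}{ds}+Gv=0$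 in the coordinate $s=x$, or $s=1/x$ at $x=\infty$, then the coefficient $G-\frac12\frac{dF}{ds}-\frac14F^2$ of its normal form does not extend holomorphically to that point). Suppose that $E'$ has exactly $6$ non-apparent singularities, and that it has $3$ apparent singularities in the following sense: either exactly $3$ apparent singularities of $E'$ lie outside $\phi^{-1}(\{0,1,\infty\})$; or $E$ has exponent difference $\pm\frac1{p_i}$ at each $i\in\{0,1,\infty\}$ with $p_i<\infty$, and $E'$ has exactly $3$ apparent singularities in all. Then: 1. $d-\left(\lfloor\frac d{p_0}\rfloor+\lfloor\frac d{p_1}\rfloor+\lfloor\frac d{p_\infty}\rfloor\right)=1$; 2. $\left(1-\frac1{p_0}-\frac1{p_1}-\frac1{p_\infty}\right)d\le 1-\frac6{p_\infty}$; 3. if $p_\infty>d$, then $\frac1d+\frac1{p_0}+\frac1{p_1}\ge1$; 4. if $p_\infty\le d$, then $\left(1-\frac1{p_0}-\frac1{p_1}\right)p_\infty^2-2p_\infty+6\le0$ and $\frac56\le\frac1{p_0}+\frac1{p_1}<1$. -/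

import Mathlib

namespace Fuchs

/-- A second order linear differential equation `u'' + f u' + g u = 0` in the affine coordinate
of `ℙ¹ = OnePoint ℂ`. Only the values of `f` and `g` on punctured neighbourhoods of points are
ever used, so the values at poles are irrelevant. -/
structure LinearODE where
  f : ℂ → ℂ
  g : ℂ → ℂ

namespace LinearODE

/-- The equation satisfied by `v = u ∘ φ` when `u'' + f u' + g u = 0`:
`v'' + (φ' f(φ) - φ''/φ') v' + φ'² g(φ) v = 0`. -/
noncomputable def pullback (E : LinearODE) (φ : ℂ → ℂ) : LinearODE where
  f := fun x => deriv φ x * E.f (φ x) - deriv (deriv φ) x / deriv φ x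
  g := fun x => deriv φ x ^ 2 * E.g (φ x)

/-- The equation written in the coordinate `y = 1/x` centred at infinity. -/
noncomputable def atInfty (E : LinearODE) : LinearODE := E.pullback (fun y => y⁻¹)

/-- The half-plane `{w | |exp w| < r}`; the map `w ↦ a + exp w` makes it the universal cover of
the punctured disc of radius `r` around `a`. -/
def logDisc (r : ℝ) : Set ℂ := {w : ℂ | Real.exp w.re < r}

/-- `U` is a (multivalued) holomorphic solution of `E` on the punctured disc of radius `r` around
`a`, seen on the universal cover: `U w = u (a + exp w)`. Since `U' = exp w * u'` and
`U'' = exp (2 w) * u'' + exp w * u'`, the equation `u'' + f u' + g u = 0` becomes the one below. -/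
def IsSolution (E : LinearODE) (a : ℂ) (r : ℝ) (U : ℂ → ℂ) : Prop :=
  DifferentiableOn ℂ U (logDisc r) ∧
  ∀ w ∈ logDisc r,
    deriv (deriv U) w - deriv U w
      + Complex.exp w * E.f (a + Complex.exp w) * deriv U w
      + Complex.exp w ^ 2 * E.g (a + Complex.exp w) * U w = 0

/-- The `n`-th power of the local monodromy of `E` around `a` is a scalar matrix: near `a` there is
a basis `U, V` of multivalued solutions each of which is multiplied by the same constant `c` under
analytic continuation `n` times around `a`. -/
def MonodromyPowIsScalar (E : LinearODE) (a : ℂ) (n : ℕ) : Prop :=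
  ∃ r : ℝ, 0 < r ∧ ∃ U V : ℂ → ℂ, E.IsSolution a r U ∧ E.IsSolution a r V ∧
    (∀ s t : ℂ, (∀ w ∈ logDisc r, s * U w + t * V w = 0) → s = 0 ∧ t = 0) ∧
    ∃ c : ℂ, ∀ w ∈ logDisc r,
      U (w + n * (2 * Real.pi * Complex.I)) = c * U w ∧
      V (w + n * (2 * Real.pi * Complex.I)) = c * V w

/-- Order in `PGL(2, ℂ)` of the local monodromy of `E` around the finite point `a`; it is `⊤` when
no positive power is trivial. -/
noncomputable def orderAt (E : LinearODE) (a : ℂ) : ℕ∞ :=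
  sInf {m : ℕ∞ | ∃ n : ℕ, 1 ≤ n ∧ m = n ∧ E.MonodromyPowIsScalar a n}

/-- Order in `PGL(2, ℂ)` of the local monodromy of `E` around a point of `ℙ¹`. -/
noncomputable def order (E : LinearODE) : OnePoint ℂ → ℕ∞
  | none => E.atInfty.orderAt 0
  | some a => E.orderAt a

/-- The coefficient `q = g - f'/2 - f²/4` of the normal form `v'' + q v = 0` of the equation, which
only depends on the projective structure induced by the equation. -/
noncomputable def normalCoeff (E : LinearODE) (x : ℂ) : ℂ :=
  E.g x - deriv E.f x / 2 - E.f x ^ 2 / 4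

/-- The projective structure of `E` is regular at the finite point `a`: the coefficient of the
normal form extends holomorphically to `a`. -/
def IsRegularAt (E : LinearODE) (a : ℂ) : Prop :=
  ∃ h : ℂ → ℂ, AnalyticAt ℂ h a ∧ ∀ᶠ x in nhdsWithin a {a}ᶜ, E.normalCoeff x = h x

/-- The projective structure of `E` is regular at a point of `ℙ¹`. -/
def IsRegular (E : LinearODE) : OnePoint ℂ → Prop
  | none => E.atInfty.IsRegularAt 0
  | some a => E.IsRegularAt a

/-- A non-apparent singularity: the local monodromy in `PGL(2, ℂ)` is not trivial (at a regular
point it always is). -/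
def IsNonApparentSingularity (E : LinearODE) (x : OnePoint ℂ) : Prop := E.order x ≠ 1

/-- An apparent singularity: a singular point with trivial local monodromy in `PGL(2, ℂ)`. -/
def IsApparentSingularity (E : LinearODE) (x : OnePoint ℂ) : Prop :=
  ¬ E.IsRegular x ∧ E.order x = 1

end LinearODE

/-- A Riemann scheme with three singular points: exponents `α₁, α₂` at `0`, `β₁, β₂` at `1` and
`γ₁, γ₂` at `∞`, subject to the relation of Fuchs. -/
structure RiemannScheme where
  (α₁ α₂ β₁ β₂ γ₁ γ₂ : ℂ)
  fuchs : α₁ + α₂ + β₁ + β₂ + γ₁ + γ₂ = 1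

/-- The hypergeometric equation with the given Riemann scheme. These are all the Fuchsian equations
on `ℙ¹` of order two with no singular point outside `{0, 1, ∞}`; Gauss's equation with parameters
`a, b, c` has exponents `0, 1 - c` at `0`, `0, c - a - b` at `1` and `a, b` at `∞`. -/
noncomputable def RiemannScheme.equation (S : RiemannScheme) : LinearODE where
  f := fun z => (1 - S.α₁ - S.α₂) / z + (1 - S.β₁ - S.β₂) / (z - 1)
  g := fun z => S.α₁ * S.α₂ / z ^ 2 + S.β₁ * S.β₂ / (z - 1) ^ 2
    + (S.γ₁ * S.γ₂ - S.α₁ * S.α₂ - S.β₁ * S.β₂) / (z * (z - 1))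

/-- At each of `0, 1, ∞` whose weight `p` is finite, the exponent difference is `± 1 / p`. -/
def RiemannScheme.HasReciprocalExponents (S : RiemannScheme) (p0 p1 pinf : ℕ∞) : Prop :=
  (∀ n : ℕ, p0 = n → (S.α₁ - S.α₂) ^ 2 = (1 / (n : ℂ)) ^ 2) ∧
  (∀ n : ℕ, p1 = n → (S.β₁ - S.β₂) ^ 2 = (1 / (n : ℂ)) ^ 2) ∧
  (∀ n : ℕ, pinf = n → (S.γ₁ - S.γ₂) ^ 2 = (1 / (n : ℂ)) ^ 2)

/-- The degree of the ramified covering `φ : ℙ¹ → ℙ¹` given by a rational function. -/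
noncomputable def degree (φ : RatFunc ℂ) : ℕ := max φ.num.natDegree φ.denom.natDegree

/-- The function of an affine variable defined by a rational function (used away from its poles). -/
noncomputable def affineFun (φ : RatFunc ℂ) (x : ℂ) : ℂ := φ.num.eval x / φ.denom.eval x

open Classical in
/-- The map `ℙ¹ → ℙ¹` defined by a rational function (its denominator is monic). -/
noncomputable def toMap (φ : RatFunc ℂ) : OnePoint ℂ → OnePoint ℂ
  | none => if φ.denom.natDegree < φ.num.natDegree then OnePoint.infty
      else ((φ.num.coeff φ.denom.natDegree : ℂ) : OnePoint ℂ)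
  | some x => if φ.denom.eval x = 0 then OnePoint.infty else ((affineFun φ x : ℂ) : OnePoint ℂ)

/-- `1 / p` for `p ∈ ℕ ∪ {∞}`, with `1 / ∞ = 0`. -/
noncomputable def recip : ℕ∞ → ℝ
  | none => 0
  | some n => 1 / (n : ℝ)

/-- The three poles `0, 1, ∞` of a hypergeometric equation. -/
def poles : Set (OnePoint ℂ) := {((0 : ℂ) : OnePoint ℂ), ((1 : ℂ) : OnePoint ℂ), OnePoint.infty}

end Fuchs

/-! Everything comes from one count over the fibres above `0, 1, ∞`. Riemann–Hurwitz gives these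
fibres at least `d + 2 + k` points together, where `k` is the number of chosen apparent
singularities outside them. Such singularities are ramified, since an unramified pull-back of an
ordinary point is regular (`two_le_ram`).

Let `x` lie over the pole `i`, with ramification index `e`. If the monodromy of `E'` at `x` is
trivial, the `e`-th power of the monodromy of `E` at `i` is scalar, so `p_i` divides `e`
(`exists_order_dvd_ram`). If moreover the exponent difference is `±1/p_i` and `x` is singular, then
`e ≥ 2 p_i`: for `e = p_i` the pulled-back exponent difference is `±1` without logarithmic
obstruction, so the projective structure is regular (`two_mul_le_ram`). Otherwise `x` is one of the
six non-apparent singularities, and `e / p_i ≥ 1 / p_∞`.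

Let `n_i` count the points of trivial monodromy over `i`, with the apparent singularities counted
twice in the case of reciprocal exponents, and let `b_i` count the others. Summing `e / p_i` over a
fibre gives `n_i + b_i / p_∞ ≤ d / p_i`. The global count gives `∑ n_i + ∑ b_i ≥ d + 5` with `∑ b_i
≤ 6`, so `∑ n_i ≥ d - 1`, whereas hyperbolicity forces `∑ n_i < d`. Hence `∑ n_i = d - 1` and `∑ b_i
= 6`, and the four claims follow by arithmetic (`arithmetic_of_fibre_bounds`). -/

namespace Fuchs

/-! ### Fibres, ramification indices and the Riemann–Hurwitz inequality -/

open Polynomial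

/-- The local coordinate parametrisation of `ℙ¹` centred at a point. -/
noncomputable def chart : OnePoint ℂ → ℂ → ℂ
  | none => fun s => s⁻¹
  | some a => fun s => a + s

/-- The polynomial whose zeros are the finite points of a fibre of `φ`. -/
noncomputable def fibrePoly (φ : RatFunc ℂ) : OnePoint ℂ → ℂ[X]
  | none => φ.denom
  | some c => φ.num - C c * φ.denom

/-- The order of vanishing at a point of `ℙ¹` of a form of degree `d` given by its
dehomogenisation. -/
noncomputable def multAt (d : ℕ) (F : ℂ[X]) : OnePoint ℂ → ℕ
  | none => d - F.natDegree
  | some x => F.rootMultiplicity x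

/-- The ramification index of `φ` at a point of `ℙ¹`. -/
noncomputable def ram (φ : RatFunc ℂ) (x : OnePoint ℂ) : ℕ :=
  multAt (degree φ) (fibrePoly φ (toMap φ x)) x

section Polynomials

variable {φ : RatFunc ℂ}

theorem isCoprime_fibrePoly_denom (c : ℂ) :
    IsCoprime (fibrePoly φ (c : OnePoint ℂ)) φ.denom := by
  have h := φ.isCoprime_num_denom
  have : fibrePoly φ (c : OnePoint ℂ) = φ.num + φ.denom * (- C c) := by
    change φ.num - C c * φ.denom = _
    ring
  rw [this]
  exact h.add_mul_left_left _

theorem natDegree_fibrePoly_le (c : OnePoint ℂ) : (fibrePoly φ c).natDegree ≤ degree φ := by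
  induction c using OnePoint.rec with
  | infty => exact le_max_right _ _
  | coe c =>
    refine (natDegree_sub_le _ _).trans (max_le (le_max_left _ _) ?_)
    exact (natDegree_C_mul_le _ _).trans (le_max_right _ _)

theorem fibrePoly_ne_zero (hd : 1 ≤ degree φ) (c : OnePoint ℂ) : fibrePoly φ c ≠ 0 := by
  induction c using OnePoint.rec with
  | infty => exact φ.denom_ne_zero
  | coe c =>
    intro h0
    have h := isCoprime_fibrePoly_denom (φ := φ) c
    rw [h0, isCoprime_zero_left] at h
    have h1 := natDegree_eq_zero_of_isUnit h
    have h2 : φ.num = C c * φ.denom := sub_eq_zero.1 h0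
    have h3 : φ.num.natDegree = 0 := by
      have := natDegree_C_mul_le c φ.denom
      rw [h2]; omega
    rw [degree, h1, h3] at hd
    simp at hd

theorem toMap_coe_eq_iff (x : ℂ) (c : OnePoint ℂ) :
    toMap φ (x : OnePoint ℂ) = c ↔ (fibrePoly φ c).eval x = 0 := by
  have hx : toMap φ (x : OnePoint ℂ) = if φ.denom.eval x = 0 then OnePoint.infty
    else ((affineFun φ x : ℂ) : OnePoint ℂ) := rfl
  rw [hx]
  induction c using OnePoint.rec with
  | infty =>
    change _ ↔ φ.denom.eval x = 0
    split_ifs with h <;> simp [h]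
  | coe c =>
    change _ ↔ (φ.num - C c * φ.denom).eval x = 0
    split_ifs with h
    · have : φ.num.eval x ≠ 0 := by
        obtain ⟨a, b, hab⟩ := φ.isCoprime_num_denom
        intro h'
        have := congrArg (eval x) hab
        simp [h, h'] at this
      simp [h, this]
    · rw [OnePoint.coe_eq_coe, affineFun, div_eq_iff h]
      simp [sub_eq_zero]

theorem toMap_infty_eq_iff (hd : 1 ≤ degree φ) (c : OnePoint ℂ) :
    toMap φ OnePoint.infty = c ↔ (fibrePoly φ c).natDegree < degree φ := by
  have hx : toMap φ OnePoint.infty = if φ.denom.natDegree < φ.num.natDegree then OnePoint.infty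
      else ((φ.num.coeff φ.denom.natDegree : ℂ) : OnePoint ℂ) := rfl
  rw [hx]
  induction c using OnePoint.rec with
  | infty =>
    change _ ↔ φ.denom.natDegree < max _ _
    split_ifs with h <;> simp [h]
  | coe c =>
    have hle := natDegree_fibrePoly_le (φ := φ) (c : OnePoint ℂ)
    have hcd := natDegree_C_mul_le c φ.denom
    have hF : fibrePoly φ (c : OnePoint ℂ) = φ.num - C c * φ.denom := rfl
    rw [hF] at *
    split_ifs with h
    · have : (φ.num - C c * φ.denom).natDegree = φ.num.natDegree :=
        natDegree_sub_eq_left_of_natDegree_lt (by omega)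
      simp [this, degree, h.le]
    · have hdeg : degree φ = φ.denom.natDegree := max_eq_right (by omega)
      rw [OnePoint.coe_eq_coe, hdeg]
      rw [hdeg] at hle hd
      have hco : (φ.num - C c * φ.denom).coeff φ.denom.natDegree
          = φ.num.coeff φ.denom.natDegree - c := by
        simp [φ.monic_denom.coeff_natDegree]
      constructor
      · intro hc
        refine lt_of_le_of_ne hle fun heq => ?_
        have h0 : (φ.num - C c * φ.denom).leadingCoeff = 0 := by
          rw [leadingCoeff, heq, hco, hc, sub_self]
        rw [leadingCoeff_eq_zero] at h0
        rw [h0] at heq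
        simp at heq
        omega
      · intro hlt
        have := coeff_eq_zero_of_natDegree_lt hlt
        rw [hco, sub_eq_zero] at this
        exact this

theorem toMap_eq_iff (hd : 1 ≤ degree φ) (x c : OnePoint ℂ) :
    toMap φ x = c ↔ 0 < multAt (degree φ) (fibrePoly φ c) x := by
  induction x using OnePoint.rec with
  | infty =>
    rw [toMap_infty_eq_iff hd]
    exact Nat.sub_pos_iff_lt.symm
  | coe x =>
    rw [toMap_coe_eq_iff]
    exact (rootMultiplicity_pos (fibrePoly_ne_zero hd c)).symm

theorem ram_pos (hd : 1 ≤ degree φ) (x : OnePoint ℂ) : 0 < ram φ x :=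
  (toMap_eq_iff hd x _).1 rfl

-- A nonzero form of degree `d` has `d` zeros on `ℙ¹`: the finite roots account for its `natDegree`,
-- and `∞` for the defect.
open Classical in
theorem exists_fibre (hd : 1 ≤ degree φ) (c : OnePoint ℂ) :
    ∃ s : Finset (OnePoint ℂ), (∀ x, x ∈ s ↔ toMap φ x = c) ∧ ∑ x ∈ s, ram φ x = degree φ := by
  set F := fibrePoly φ c with hF
  have hF0 : F ≠ 0 := fibrePoly_ne_zero hd c
  -- `∞` is inserted whether or not it lies in the fibre; if it does not, its multiplicity is `0`.
  have hmem : ∀ x, x ∈ insert OnePoint.infty (F.roots.toFinset.image ((↑) : ℂ → OnePoint ℂ)) →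
      toMap φ x ≠ c → multAt (degree φ) F x = 0 := by
    intro x _ hx
    have := mt (toMap_eq_iff hd x c).2 hx
    simpa using this
  refine ⟨(insert OnePoint.infty (F.roots.toFinset.image ((↑) : ℂ → OnePoint ℂ))).filter
    (fun x => toMap φ x = c), ?_, ?_⟩
  · intro x
    rw [Finset.mem_filter, and_iff_right_iff_imp]
    intro hx
    induction x using OnePoint.rec with
    | infty => simp
    | coe x =>
      rw [toMap_coe_eq_iff, ← hF] at hx
      simp [hF0, hx]
  · have h1 : ∀ x ∈ (insert OnePoint.infty (F.roots.toFinset.image ((↑) : ℂ → OnePoint ℂ))).filter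
        (fun x => toMap φ x = c), ram φ x = multAt (degree φ) F x := by
      intro x hx
      rw [Finset.mem_filter] at hx
      rw [ram, hx.2]
    rw [Finset.sum_congr rfl h1, Finset.sum_filter_of_ne
      (fun x hx h => by by_contra h'; exact h (hmem x hx h')),
      Finset.sum_insert (by simp), Finset.sum_image (fun a _ b _ h => OnePoint.coe_injective h)]
    have h2 : ∑ x ∈ F.roots.toFinset, multAt (degree φ) F (x : OnePoint ℂ) = F.natDegree := by
      rw [← (IsAlgClosed.splits F).natDegree_eq_card_roots.symm, ← Multiset.toFinset_sum_count_eq]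
      exact Finset.sum_congr rfl fun x _ => (count_roots F).symm
    rw [h2]
    exact Nat.sub_add_cancel (natDegree_fibrePoly_le c)

theorem wronskian_num_denom_ne_zero (hd : 1 ≤ degree φ) : wronskian φ.num φ.denom ≠ 0 := by
  intro h
  rw [φ.isCoprime_num_denom.wronskian_eq_zero_iff] at h
  have h1 := derivative_eq_zero.1 h.1
  have h2 := derivative_eq_zero.1 h.2
  rw [degree, h1, h2] at hd
  simp at hd

/-- One Wronskian thus controls the ramification in all fibres at once. -/
theorem wronskian_fibrePoly (c : ℂ) :
    wronskian (fibrePoly φ (c : OnePoint ℂ)) φ.denom = wronskian φ.num φ.denom := by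
  change wronskian (φ.num - C c * φ.denom) φ.denom = _
  simp only [wronskian, derivative_sub, derivative_mul, derivative_C]
  ring

theorem pow_dvd_wronskian_left {a b : ℂ[X]} {x : ℂ} {n : ℕ} (h : (X - C x) ^ n ∣ a) :
    (X - C x) ^ (n - 1) ∣ wronskian a b := by
  refine dvd_sub (Dvd.dvd.mul_right ((pow_dvd_pow _ (Nat.sub_le n 1)).trans h) _)
    (Dvd.dvd.mul_right ?_ _)
  exact pow_sub_one_dvd_derivative_of_pow_dvd h

theorem ram_sub_one_le (hd : 1 ≤ degree φ) (x : ℂ) :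
    ram φ (x : OnePoint ℂ) - 1 ≤ (wronskian φ.num φ.denom).rootMultiplicity x := by
  rw [le_rootMultiplicity_iff (wronskian_num_denom_ne_zero hd)]
  rw [ram]
  generalize toMap φ (x : OnePoint ℂ) = c
  change (X - C x) ^ ((fibrePoly φ c).rootMultiplicity x - 1) ∣ _
  have h := pow_rootMultiplicity_dvd (fibrePoly φ c) x
  induction c using OnePoint.rec with
  | infty =>
    rw [← wronskian_neg_eq, dvd_neg]
    exact pow_dvd_wronskian_left h
  | coe c =>
    rw [← wronskian_fibrePoly c]
    exact pow_dvd_wronskian_left h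

/-- As a form of degree `2d - 2`, the Wronskian vanishes at `∞` to order at least `ram - 1`:
replacing the numerator by the fibre polynomial of the value at `∞` lowers one degree to `d - ram`
without changing the Wronskian. -/
theorem natDegree_wronskian_add_ram_infty (hd : 1 ≤ degree φ) :
    (wronskian φ.num φ.denom).natDegree + ram φ OnePoint.infty + 1 ≤ 2 * degree φ := by
  have hw := wronskian_num_denom_ne_zero hd
  have hram : ram φ OnePoint.infty =
    degree φ - (fibrePoly φ (toMap φ OnePoint.infty)).natDegree := rfl
  have hle := natDegree_fibrePoly_le (φ := φ) (toMap φ OnePoint.infty)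
  have hn : φ.num.natDegree ≤ degree φ := le_max_left _ _
  have hdd : φ.denom.natDegree ≤ degree φ := le_max_right _ _
  rw [hram]
  generalize toMap φ OnePoint.infty = c at *
  induction c using OnePoint.rec with
  | infty =>
    have h1 := natDegree_wronskian_lt_add hw
    have : fibrePoly φ OnePoint.infty = φ.denom := rfl
    rw [this] at *
    omega
  | coe c =>
    rw [← wronskian_fibrePoly c] at hw ⊢
    have h1 := natDegree_wronskian_lt_add hw
    omega

/-- The Wronskian has at most `2d - 2` zeros on `ℙ¹`. Only this half of Riemann–Hurwitz is needed.
-/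
theorem sum_ram_sub_one_le (hd : 1 ≤ degree φ) (s : Finset (OnePoint ℂ)) :
    ∑ x ∈ s, (ram φ x - 1) + 2 ≤ 2 * degree φ := by
  classical
  set W := wronskian φ.num φ.denom with hW
  have hs : s ⊆ insert OnePoint.infty ((s.preimage ((↑) : ℂ → OnePoint ℂ)
      OnePoint.coe_injective.injOn).image (↑)) := by
    intro x hx
    induction x using OnePoint.rec with
    | infty => simp
    | coe x => simp [hx]
  have h1 := Finset.sum_le_sum_of_subset (f := fun x => ram φ x - 1) hs
  rw [Finset.sum_insert (by simp),
    Finset.sum_image (fun a _ b _ h => OnePoint.coe_injective h)] at h1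
  have h2 : ∀ t : Finset ℂ, ∑ x ∈ t, (ram φ (x : OnePoint ℂ) - 1) ≤ W.natDegree := by
    intro t
    calc ∑ x ∈ t, (ram φ (x : OnePoint ℂ) - 1) ≤ ∑ x ∈ t, W.roots.count x :=
          Finset.sum_le_sum fun x _ => (count_roots W).symm ▸ ram_sub_one_le hd x
      _ ≤ ∑ x ∈ t ∪ W.roots.toFinset, W.roots.count x :=
          Finset.sum_le_sum_of_subset Finset.subset_union_left
      _ = W.roots.card := Multiset.sum_count_eq_card fun x hx => by simp [Multiset.mem_toFinset.2 hx]
      _ ≤ W.natDegree := card_roots' W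
  have h3 := natDegree_wronskian_add_ram_infty hd
  have h4 := ram_pos hd OnePoint.infty
  rw [← hW] at h3
  have h5 := h2 (s.preimage ((↑) : ℂ → OnePoint ℂ) OnePoint.coe_injective.injOn)
  omega

end Polynomials

/-! ### Local form `s ^ e * h s` of a rational map -/

open Filter Topology

theorem chart_infty : chart OnePoint.infty = fun s => s⁻¹ := rfl

theorem chart_coe (a : ℂ) : chart (a : OnePoint ℂ) = fun s => a + s := rfl

theorem fibrePoly_infty (φ : RatFunc ℂ) : fibrePoly φ OnePoint.infty = φ.denom := rfl

theorem fibrePoly_coe (φ : RatFunc ℂ) (c : ℂ) :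
    fibrePoly φ (c : OnePoint ℂ) = φ.num - C c * φ.denom := rfl

theorem chart_injective (x : OnePoint ℂ) : Function.Injective (chart x) := by
  induction x using OnePoint.rec with
  | infty => exact inv_injective
  | coe x => exact add_right_injective x

theorem eventually_chart_notMem (x : OnePoint ℂ) {T : Set ℂ} (hT : T.Finite) :
    ∀ᶠ s in 𝓝[≠] (0 : ℂ), chart x s ∉ T := by
  have h := (hT.preimage (chart_injective x).injOn).compl_mem_cofinite
  exact nhdsNE_le_cofinite _ h

theorem eventually_eval_chart_ne_zero (x : OnePoint ℂ) {p : ℂ[X]} (hp : p ≠ 0) :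
    ∀ᶠ s in 𝓝[≠] (0 : ℂ), p.eval (chart x s) ≠ 0 := by
  filter_upwards [eventually_chart_notMem x p.roots.toFinset.finite_toSet] with s hs h
  exact hs (by simp [hp, h])

theorem analyticAt_eval (p : ℂ[X]) (z : ℂ) : AnalyticAt ℂ (fun s => p.eval s) z :=
  p.differentiable.analyticAt z

theorem analyticAt_affineFun {φ : RatFunc ℂ} {z : ℂ} (hz : φ.denom.eval z ≠ 0) :
    AnalyticAt ℂ (affineFun φ) z :=
  (analyticAt_eval φ.num z).div (analyticAt_eval φ.denom z) hz

theorem analyticAt_chart (x : OnePoint ℂ) {s : ℂ} (hs : s ≠ 0) : AnalyticAt ℂ (chart x) s := by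
  induction x using OnePoint.rec with
  | infty => exact analyticAt_inv hs
  | coe x => exact analyticAt_const.add analyticAt_id

theorem eval_inv_eq_reverse (F : ℂ[X]) {s : ℂ} (hs : s ≠ 0) :
    F.eval s⁻¹ * s ^ F.natDegree = F.reverse.eval s := by
  let _ := invertibleOfNonzero hs
  let _ := invertibleOfNonzero (inv_ne_zero hs)
  have h := eval₂_reverse_mul_pow (RingHom.id ℂ) s⁻¹ F
  rw [eval₂_id, eval₂_id, invOf_eq_inv, inv_inv] at h
  rw [← h, mul_assoc, ← mul_pow, inv_mul_cancel₀ hs, one_pow, mul_one]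

/-- The quotient of two forms of degree `d` in a local coordinate where the denominator does not
vanish. -/
theorem exists_quotient_local_form {d : ℕ} {F G : ℂ[X]} (hF0 : F ≠ 0) (hG0 : G ≠ 0)
    (hF : F.natDegree ≤ d) (hG : G.natDegree ≤ d) (x : OnePoint ℂ) (hGx : multAt d G x = 0) :
    ∃ h : ℂ → ℂ, AnalyticAt ℂ h 0 ∧ h 0 ≠ 0 ∧
      ∀ᶠ s in 𝓝[≠] (0 : ℂ), F.eval (chart x s) / G.eval (chart x s) = s ^ multAt d F x * h s := by
  induction x using OnePoint.rec with
  | infty =>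
    have hGd : G.natDegree = d := le_antisymm hG (Nat.sub_eq_zero_iff_le.1 hGx)
    have hR : ∀ P : ℂ[X], P ≠ 0 → P.reverse.eval 0 ≠ 0 := fun P hP => by
      rw [← coeff_zero_eq_eval_zero, coeff_zero_reverse]
      exact leadingCoeff_ne_zero.2 hP
    refine ⟨fun s => F.reverse.eval s / G.reverse.eval s,
      (analyticAt_eval _ _).div (analyticAt_eval _ _) (hR G hG0),
      div_ne_zero (hR F hF0) (hR G hG0), ?_⟩
    filter_upwards [self_mem_nhdsWithin] with s hs
    have hs : s ≠ 0 := hs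
    change F.eval s⁻¹ / G.eval s⁻¹ = s ^ (d - F.natDegree) * (F.reverse.eval s / G.reverse.eval s)
    rw [← eval_inv_eq_reverse F hs, ← eval_inv_eq_reverse G hs, hGd]
    obtain ⟨k, rfl⟩ := Nat.exists_eq_add_of_le hF
    rw [Nat.add_sub_cancel_left, pow_add]
    have := pow_ne_zero F.natDegree hs
    have := pow_ne_zero k hs
    by_cases hz : G.eval s⁻¹ = 0
    · simp [hz]
    · field_simp
  | coe x =>
    have hGx : G.eval x ≠ 0 := fun h => by
      have := (rootMultiplicity_pos hG0).2 h
      exact this.ne' hGx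
    obtain ⟨q, hq, hnd⟩ := F.exists_eq_pow_rootMultiplicity_mul_and_not_dvd hF0 x
    rw [dvd_iff_isRoot] at hnd
    have ha : ∀ P : ℂ[X], AnalyticAt ℂ (fun s => P.eval (x + s)) 0 := fun P =>
      AnalyticAt.fun_comp (analyticAt_eval P _) (analyticAt_const.add analyticAt_id)
    refine ⟨fun s => q.eval (x + s) / G.eval (x + s), (ha q).div (ha G) (by simpa using hGx),
      div_ne_zero (by simpa using hnd) (by simpa using hGx), Eventually.of_forall fun s => ?_⟩
    change F.eval (x + s) / G.eval (x + s) = s ^ F.rootMultiplicity x * _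
    conv_lhs => rw [hq]
    simp [mul_div_assoc]

/-- Over a finite value `c`, the function `φ - c` is the quotient of the fibre polynomials of `c`
and `∞`; over `∞`, `1 / φ` is that of `∞` and `0`. -/
theorem exists_local_form {φ : RatFunc ℂ} (hd : 1 ≤ degree φ) (x : OnePoint ℂ) :
    ∃ h : ℂ → ℂ, AnalyticAt ℂ h 0 ∧ h 0 ≠ 0 ∧ ∀ᶠ s in 𝓝[≠] (0 : ℂ),
      affineFun φ (chart x s) = chart (toMap φ x) (s ^ ram φ x * h s) := by
  have key : ∀ c : OnePoint ℂ, toMap φ x ≠ c → multAt (degree φ) (fibrePoly φ c) x = 0 :=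
    fun c hc => by simpa using mt (toMap_eq_iff hd x c).2 hc
  have hram : ram φ x = multAt (degree φ) (fibrePoly φ (toMap φ x)) x := rfl
  rw [hram]
  clear hram
  generalize toMap φ x = c at *
  induction c using OnePoint.rec with
  | infty =>
    obtain ⟨h, ha, h0, hh⟩ := exists_quotient_local_form (fibrePoly_ne_zero hd OnePoint.infty)
      (fibrePoly_ne_zero hd ((0 : ℂ) : OnePoint ℂ)) (natDegree_fibrePoly_le _)
      (natDegree_fibrePoly_le _) x (key _ (OnePoint.infty_ne_coe _))
    refine ⟨h, ha, h0, hh.mono fun s hs => ?_⟩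
    rw [← hs]
    simp [affineFun, fibrePoly_coe, fibrePoly_infty, chart_infty]
  | coe c =>
    obtain ⟨h, ha, h0, hh⟩ := exists_quotient_local_form (fibrePoly_ne_zero hd (c : OnePoint ℂ))
      (fibrePoly_ne_zero hd OnePoint.infty) (natDegree_fibrePoly_le _)
      (natDegree_fibrePoly_le _) x (key _ (OnePoint.coe_ne_infty _))
    refine ⟨h, ha, h0, ?_⟩
    filter_upwards [hh, eventually_eval_chart_ne_zero x φ.denom_ne_zero] with s hs hs'
    rw [← hs]
    rw [affineFun, chart_coe, fibrePoly_coe, fibrePoly_infty, eval_sub, eval_mul, eval_C]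
    field_simp
    ring

theorem eventually_nhdsNE_eventually_nhds {p : ℂ → Prop} {a : ℂ} (h : ∀ᶠ s in 𝓝[≠] a, p s) :
    ∀ᶠ s in 𝓝[≠] a, ∀ᶠ t in 𝓝 s, p t := by
  filter_upwards [eventually_eventually_nhdsWithin.2 h, self_mem_nhdsWithin] with s hs hsa
  rwa [IsOpen.nhdsWithin_eq isOpen_compl_singleton hsa] at hs

/-! ### Calculus of pull-backs -/

namespace LinearODE

/-- Two equations have the same coefficients at a point. -/
def AgreeAt (F G : LinearODE) (s : ℂ) : Prop := F.f s = G.f s ∧ F.g s = G.g s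

theorem AgreeAt.symm {F G : LinearODE} {s : ℂ} (h : F.AgreeAt G s) : G.AgreeAt F s :=
  ⟨h.1.symm, h.2.symm⟩

theorem AgreeAt.trans {F G H : LinearODE} {s : ℂ} (h : F.AgreeAt G s) (h' : G.AgreeAt H s) :
    F.AgreeAt H s :=
  ⟨h.1.trans h'.1, h.2.trans h'.2⟩

theorem AgreeAt.pullback {F G : LinearODE} {ψ : ℂ → ℂ} {s : ℂ} (h : F.AgreeAt G (ψ s)) :
    (F.pullback ψ).AgreeAt (G.pullback ψ) s := by
  simp [AgreeAt, LinearODE.pullback, h.1, h.2]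

theorem agreeAt_pullback_of_eventuallyEq (F : LinearODE) {φ ψ : ℂ → ℂ} {s : ℂ}
    (h : φ =ᶠ[𝓝 s] ψ) : (F.pullback φ).AgreeAt (F.pullback ψ) s := by
  simp [AgreeAt, LinearODE.pullback, h.eq_of_nhds, h.deriv_eq, h.deriv.deriv_eq]

theorem deriv_comp_eventuallyEq {φ ψ : ℂ → ℂ} {s : ℂ} (hφ : AnalyticAt ℂ φ (ψ s))
    (hψ : AnalyticAt ℂ ψ s) :
    deriv (fun t => φ (ψ t)) =ᶠ[𝓝 s] fun t => deriv φ (ψ t) * deriv ψ t := by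
  filter_upwards [hψ.eventually_analyticAt,
    hψ.continuousAt.eventually hφ.eventually_analyticAt] with t h1 h2
  exact deriv_comp t h2.differentiableAt h1.differentiableAt

theorem deriv_deriv_comp {φ ψ : ℂ → ℂ} {s : ℂ} (hφ : AnalyticAt ℂ φ (ψ s))
    (hψ : AnalyticAt ℂ ψ s) :
    deriv (deriv fun t => φ (ψ t)) s
      = deriv (deriv φ) (ψ s) * deriv ψ s ^ 2 + deriv φ (ψ s) * deriv (deriv ψ) s := by
  rw [(deriv_comp_eventuallyEq hφ hψ).deriv_eq]
  have h1 : HasDerivAt (fun t => deriv φ (ψ t)) (deriv (deriv φ) (ψ s) * deriv ψ s) s :=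
    hφ.deriv.differentiableAt.hasDerivAt.comp s hψ.differentiableAt.hasDerivAt
  have h2 := h1.mul hψ.deriv.differentiableAt.hasDerivAt
  refine h2.deriv.trans ?_
  ring

/-- Functoriality of the pull-back holds only off the critical points, because its first coefficient
divides by the derivative. -/
theorem pullback_pullback_agreeAt (F : LinearODE) {φ ψ : ℂ → ℂ} {s : ℂ}
    (hφ : AnalyticAt ℂ φ (ψ s)) (hψ : AnalyticAt ℂ ψ s) (hφ' : deriv φ (ψ s) ≠ 0)
    (hψ' : deriv ψ s ≠ 0) :
    ((F.pullback φ).pullback ψ).AgreeAt (F.pullback fun t => φ (ψ t)) s := by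
  have h1 := (deriv_comp_eventuallyEq hφ hψ).eq_of_nhds
  have h2 := deriv_deriv_comp hφ hψ
  constructor
  · simp only [pullback, h1, h2]
    field_simp
    ring
  · simp only [pullback, h1]
    ring

/-- `U` satisfies the equation at a point. -/
def SolvesAt (F : LinearODE) (U : ℂ → ℂ) (w : ℂ) : Prop :=
  deriv (deriv U) w + F.f w * deriv U w + F.g w * U w = 0

theorem AgreeAt.solvesAt {F G : LinearODE} {U : ℂ → ℂ} {w : ℂ} (h : F.AgreeAt G w)
    (hU : F.SolvesAt U w) : G.SolvesAt U w := by
  rwa [SolvesAt, h.1, h.2] at hU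

theorem SolvesAt.comp {F : LinearODE} {U ψ : ℂ → ℂ} {w : ℂ} (hU : AnalyticAt ℂ U (ψ w))
    (hψ : AnalyticAt ℂ ψ w) (hψ' : deriv ψ w ≠ 0) (h : F.SolvesAt U (ψ w)) :
    (F.pullback ψ).SolvesAt (fun t => U (ψ t)) w := by
  have h1 := (deriv_comp_eventuallyEq hU hψ).eq_of_nhds
  have h2 := deriv_deriv_comp hU hψ
  simp only [SolvesAt, pullback, h1, h2]
  rw [SolvesAt] at h
  field_simp
  linear_combination deriv ψ w ^ 2 * h

/-- The equation on the universal cover is itself a pull-back, by `t ↦ a + exp t`, so changes of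
coordinate reduce to functoriality. -/
theorem isSolution_iff (E : LinearODE) (a : ℂ) (r : ℝ) (U : ℂ → ℂ) :
    E.IsSolution a r U ↔ DifferentiableOn ℂ U (logDisc r) ∧
      ∀ w ∈ logDisc r, (E.pullback fun t => a + Complex.exp t).SolvesAt U w := by
  refine and_congr_right fun _ => forall₂_congr fun w _ => ?_
  have h1 : deriv (fun t => a + Complex.exp t) = Complex.exp := by
    ext t
    rw [deriv_const_add, Complex.deriv_exp]
  have h2 := Complex.exp_ne_zero w
  rw [SolvesAt, pullback, h1, Complex.deriv_exp]
  refine Eq.congr_left ?_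
  field_simp
  ring

theorem pullback_chart_coe (E : LinearODE) (a : ℂ) :
    E.pullback (chart (a : OnePoint ℂ)) = ⟨fun s => E.f (a + s), fun s => E.g (a + s)⟩ := by
  have h1 : deriv (fun t : ℂ => a + t) = fun _ => 1 := by
    ext t
    simp
  rw [pullback, chart_coe, h1]
  simp

theorem orderAt_pullback_chart_coe (E : LinearODE) (a : ℂ) :
    (E.pullback (chart (a : OnePoint ℂ))).orderAt 0 = E.orderAt a := by
  simp [orderAt, MonodromyPowIsScalar, IsSolution, pullback_chart_coe]

theorem order_eq_orderAt (E : LinearODE) (x : OnePoint ℂ) :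
    E.order x = (E.pullback (chart x)).orderAt 0 := by
  induction x using OnePoint.rec with
  | infty => rfl
  | coe x => exact (orderAt_pullback_chart_coe E x).symm

theorem isRegular_of_isRegularAt (E : LinearODE) (x : OnePoint ℂ)
    (h : (E.pullback (chart x)).IsRegularAt 0) : E.IsRegular x := by
  induction x using OnePoint.rec with
  | infty => exact h
  | coe x =>
    obtain ⟨h, ha, hh⟩ := h
    have hx : Tendsto (fun t : ℂ => t - x) (𝓝[≠] x) (𝓝[≠] 0) := by
      refine tendsto_nhdsWithin_iff.2 ⟨?_, ?_⟩
      · have : Tendsto (fun t : ℂ => t - x) (𝓝 x) (𝓝 (x - x)) :=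
          (continuous_id.sub continuous_const).tendsto x
        rw [sub_self] at this
        exact this.mono_left nhdsWithin_le_nhds
      · filter_upwards [self_mem_nhdsWithin] with t ht
        exact sub_ne_zero.2 ht
    refine ⟨fun t => h (t - x), ?_, ?_⟩
    · refine AnalyticAt.fun_comp (f := fun t : ℂ => t - x) (by rwa [sub_self])
        (analyticAt_id.sub analyticAt_const)
    · filter_upwards [hx.eventually hh] with t ht
      rw [← ht, pullback_chart_coe]
      have h2 : deriv (fun s => E.f (x + s)) (t - x) = deriv E.f t := by
        rw [deriv_comp_const_add]
        simp
      simp [normalCoeff, h2]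

end LinearODE

theorem deriv_chart_ne_zero (x : OnePoint ℂ) {s : ℂ} (hs : s ≠ 0) : deriv (chart x) s ≠ 0 := by
  induction x using OnePoint.rec with
  | infty => simp [chart_infty, hs]
  | coe x => simp [chart_coe]

theorem deriv_pow_mul {e : ℕ} (he : 0 < e) {h : ℂ → ℂ} {s : ℂ} (hs : AnalyticAt ℂ h s) :
    deriv (fun s => s ^ e * h s) s = s ^ (e - 1) * (e * h s + s * deriv h s) := by
  have h1 := ((hasDerivAt_id s).pow e).mul hs.differentiableAt.hasDerivAt
  refine h1.deriv.trans ?_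
  obtain ⟨k, rfl⟩ := Nat.exists_eq_succ_of_ne_zero he.ne'
  simp [pow_succ]
  ring

theorem eventually_pow_mul_ne_zero {e : ℕ} (he : 0 < e) {h : ℂ → ℂ} (ha : AnalyticAt ℂ h 0)
    (h0 : h 0 ≠ 0) : ∀ᶠ s in 𝓝[≠] (0 : ℂ), AnalyticAt ℂ h s ∧ h s ≠ 0 ∧ s ^ e * h s ≠ 0 ∧
      e * h s + s * deriv h s ≠ 0 ∧ deriv (fun s => s ^ e * h s) s ≠ 0 := by
  have hc : ContinuousAt (fun s => e * h s + s * deriv h s) 0 :=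
    (continuousAt_const.mul ha.continuousAt).add (continuousAt_id.mul ha.deriv.continuousAt)
  have hc0 : (e : ℂ) * h 0 + 0 * deriv h 0 ≠ 0 := by
    have : (e : ℂ) ≠ 0 := by exact_mod_cast he.ne'
    simp [this, h0]
  filter_upwards [self_mem_nhdsWithin, nhdsWithin_le_nhds ha.eventually_analyticAt,
    nhdsWithin_le_nhds (ha.continuousAt.eventually_ne h0),
    nhdsWithin_le_nhds (hc.eventually_ne hc0)] with s hs h1 h2 h3
  have hs : s ≠ 0 := hs
  refine ⟨h1, h2, mul_ne_zero (pow_ne_zero _ hs) h2, h3, ?_⟩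
  rw [deriv_pow_mul he h1]
  exact mul_ne_zero (pow_ne_zero _ hs) h3

/-- In local coordinates, the pull-back by a rational map is the pull-back by `s ^ e * h s`. -/
theorem exists_pullback_local_form {φ : RatFunc ℂ} (hd : 1 ≤ degree φ) (E : LinearODE)
    (x : OnePoint ℂ) :
    ∃ h : ℂ → ℂ, AnalyticAt ℂ h 0 ∧ h 0 ≠ 0 ∧ ∀ᶠ s in 𝓝[≠] (0 : ℂ),
      ((E.pullback (affineFun φ)).pullback (chart x)).AgreeAt
        ((E.pullback (chart (toMap φ x))).pullback fun s => s ^ ram φ x * h s) s := by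
  obtain ⟨h, ha, h0, hh⟩ := exists_local_form hd x
  refine ⟨h, ha, h0, ?_⟩
  have he := ram_pos hd x
  filter_upwards [self_mem_nhdsWithin, eventually_nhdsNE_eventually_nhds hh,
    eventually_pow_mul_ne_zero he ha h0, eventually_eval_chart_ne_zero x φ.denom_ne_zero]
    with s hs hloc hη hden
  obtain ⟨hhs, -, hη0, -, hη'⟩ := hη
  have hs : s ≠ 0 := hs
  have hηa : AnalyticAt ℂ (fun s => s ^ ram φ x * h s) s := (analyticAt_id.pow _).mul hhs
  have hφ := analyticAt_affineFun hden
  have hx := analyticAt_chart x hs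
  have hc := analyticAt_chart (toMap φ x) hη0
  have hc' := deriv_chart_ne_zero (toMap φ x) hη0
  have hloc' : (fun t => affineFun φ (chart x t)) =ᶠ[𝓝 s]
    fun t => chart (toMap φ x) (t ^ ram φ x * h t) := hloc
  -- The chain rule on the other side of the local form writes the derivative of the composite as a
  -- product of nonzero factors.
  have hφ' : deriv (affineFun φ) (chart x s) ≠ 0 := by
    intro h0
    have h1 := hloc'.deriv_eq
    rw [(LinearODE.deriv_comp_eventuallyEq hφ hx).eq_of_nhds,
      (LinearODE.deriv_comp_eventuallyEq (ψ := fun s => s ^ ram φ x * h s) hc hηa).eq_of_nhds,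
      h0, zero_mul] at h1
    exact mul_ne_zero hc' hη' h1.symm
  refine (E.pullback_pullback_agreeAt hφ hx hφ' (deriv_chart_ne_zero x hs)).trans ?_
  refine (E.agreeAt_pullback_of_eventuallyEq hloc').trans ?_
  exact (E.pullback_pullback_agreeAt (ψ := fun s => s ^ ram φ x * h s) hc hηa hc' hη').symm

/-! ### Solutions on the universal cover and the order of the monodromy -/

namespace LinearODE

theorem logDisc_eq {r : ℝ} (hr : 0 < r) : logDisc r = {w : ℂ | w.re < Real.log r} := by
  ext w
  exact (Real.lt_log_iff_exp_lt hr).symm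

theorem mem_logDisc_iff {r : ℝ} {w : ℂ} : w ∈ logDisc r ↔ ‖Complex.exp w‖ < r := by
  rw [Complex.norm_exp]
  rfl

theorem isOpen_logDisc (r : ℝ) : IsOpen (logDisc r) :=
  isOpen_lt (Real.continuous_exp.comp Complex.continuous_re) continuous_const

theorem isPreconnected_logDisc {r : ℝ} (hr : 0 < r) : IsPreconnected (logDisc r) := by
  rw [logDisc_eq hr]
  exact (convex_halfSpace_re_lt _).isPreconnected

theorem exists_mem_logDisc {r : ℝ} (hr : 0 < r) : ∃ w, w ∈ logDisc r := by
  rw [logDisc_eq hr]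
  exact ⟨((Real.log r - 1 : ℝ) : ℂ), by simp⟩

theorem logDisc_mono {r r' : ℝ} (h : r ≤ r') : logDisc r ⊆ logDisc r' :=
  fun _ hw => lt_of_lt_of_le hw h

theorem add_mem_logDisc {r : ℝ} {w : ℂ} (hw : w ∈ logDisc r) (n : ℕ) :
    w + n * (2 * Real.pi * Complex.I) ∈ logDisc r := by
  simpa [logDisc] using hw

theorem exp_add_mul_two_pi_I (w : ℂ) (n : ℕ) :
    Complex.exp (w + n * (2 * Real.pi * Complex.I)) = Complex.exp w := by
  rw [Complex.exp_add, Complex.exp_nat_mul_two_pi_mul_I, mul_one]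

theorem eqOn_zero_of_eventually {U : ℂ → ℂ} {r : ℝ} {w : ℂ} (hU : DifferentiableOn ℂ U (logDisc r))
    (hw : w ∈ logDisc r) (h : ∀ᶠ t in 𝓝 w, U t = 0) : ∀ t ∈ logDisc r, U t = 0 := by
  have hr : 0 < r := (Real.exp_pos _).trans hw
  exact (hU.analyticOnNhd (isOpen_logDisc r)).eqOn_zero_of_preconnected_of_eventuallyEq_zero
    (isPreconnected_logDisc hr) hw h

/-- Two functions without a linear relation on a half-plane. -/
def Independent (r : ℝ) (U V : ℂ → ℂ) : Prop :=
  ∀ s t : ℂ, (∀ w ∈ logDisc r, s * U w + t * V w = 0) → s = 0 ∧ t = 0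

theorem Independent.mono {r r' : ℝ} {U V : ℂ → ℂ} (h : Independent r U V)
    (hU : DifferentiableOn ℂ U (logDisc r)) (hV : DifferentiableOn ℂ V (logDisc r))
    (hr' : 0 < r') (hr : r' ≤ r) : Independent r' U V := by
  intro s t hst
  refine h s t ?_
  obtain ⟨w, hw⟩ := exists_mem_logDisc hr'
  exact eqOn_zero_of_eventually ((hU.const_mul s).add (hV.const_mul t)) (logDisc_mono hr hw)
    (by filter_upwards [(isOpen_logDisc r').mem_nhds hw] with t ht using hst t ht)

theorem IsSolution.mono {E : LinearODE} {a : ℂ} {r r' : ℝ} {U : ℂ → ℂ} (h : E.IsSolution a r U)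
    (hr : r' ≤ r) : E.IsSolution a r' U :=
  ⟨h.1.mono (logDisc_mono hr), fun w hw => h.2 w (logDisc_mono hr hw)⟩

theorem SolvesAt.add {F : LinearODE} {U V : ℂ → ℂ} {w : ℂ} (hU : AnalyticAt ℂ U w)
    (hV : AnalyticAt ℂ V w) (h : F.SolvesAt U w) (h' : F.SolvesAt V w) (s t : ℂ) :
    F.SolvesAt (fun z => s * U z + t * V z) w ∧
      deriv (fun z => s * U z + t * V z) w = s * deriv U w + t * deriv V w := by
  have hd : ∀ {A B : ℂ → ℂ} {z : ℂ}, AnalyticAt ℂ A z → AnalyticAt ℂ B z →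
      deriv (fun z => s * A z + t * B z) z = s * deriv A z + t * deriv B z := fun hA hB =>
    ((hA.differentiableAt.hasDerivAt.const_mul s).add
      (hB.differentiableAt.hasDerivAt.const_mul t)).deriv
  have h1 : deriv (fun z => s * U z + t * V z) =ᶠ[𝓝 w] fun z => s * deriv U z + t * deriv V z := by
    filter_upwards [hU.eventually_analyticAt, hV.eventually_analyticAt] with z hz hz'
    exact hd hz hz'
  refine ⟨?_, hd hU hV⟩
  rw [SolvesAt] at *
  rw [h1.deriv_eq, hd hU hV, hd hU.deriv hV.deriv]
  linear_combination s * h + t * h'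

/-- A solution vanishing to order two at an ordinary point vanishes near it. -/
theorem eventually_eq_zero_of_solvesAt {F : LinearODE} {Y : ℂ → ℂ} {w : ℂ}
    (hf : AnalyticAt ℂ F.f w) (hg : AnalyticAt ℂ F.g w) (hY : AnalyticAt ℂ Y w)
    (h : ∀ᶠ t in 𝓝 w, F.SolvesAt Y t) (h0 : Y w = 0) (h1 : deriv Y w = 0) :
    ∀ᶠ t in 𝓝 w, Y t = 0 := by
  rw [← analyticOrderAt_eq_top]
  have e1 := hY.analyticOrderAt_deriv_add_one
  have e2 := hY.deriv.analyticOrderAt_deriv_add_one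
  simp only [h0, h1, sub_zero] at e1 e2
  have e3 : deriv (deriv Y) =ᶠ[𝓝 w] (-F.f) * deriv Y + (-F.g) * Y := by
    filter_upwards [h] with t ht
    rw [SolvesAt] at ht
    simp only [Pi.add_apply, Pi.mul_apply, Pi.neg_apply]
    linear_combination ht
  have e4 := analyticOrderAt_congr e3
  have e5 := le_analyticOrderAt_add (f := (-F.f) * deriv Y) (g := (-F.g) * Y) (z₀ := w)
  rw [← e4, analyticOrderAt_mul hf.neg hY.deriv, analyticOrderAt_mul hg.neg hY] at e5
  -- By the equation `Y''` vanishes at least as much as `Y'`, whereas differentiation lowers a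
  -- finite positive order by one; so all orders are infinite.
  have e6 : analyticOrderAt (deriv Y) w ≤ analyticOrderAt (deriv (deriv Y)) w := by
    refine le_trans (le_min le_add_self ?_) e5
    exact le_trans (by rw [← e1]; exact le_self_add) le_add_self
  have e7 : analyticOrderAt (deriv (deriv Y)) w = ⊤ := by
    by_contra hne
    rw [← e2] at e6
    lift analyticOrderAt (deriv (deriv Y)) w to ℕ using hne with m
    have : m + 1 ≤ m := by exact_mod_cast e6
    omega
  rw [← e1, ← e2, e7]
  rfl

/-- The coefficients are holomorphic on the punctured disc of radius `ρ` around `0`. -/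
def IsOrdinaryNear (F : LinearODE) (ρ : ℝ) : Prop :=
  ∀ s : ℂ, s ≠ 0 → ‖s‖ < ρ → AnalyticAt ℂ F.f s ∧ AnalyticAt ℂ F.g s

theorem IsOrdinaryNear.analyticAt_pullback_exp {F : LinearODE} {ρ : ℝ} (hF : F.IsOrdinaryNear ρ)
    {w : ℂ} (hw : w ∈ logDisc ρ) :
    AnalyticAt ℂ (F.pullback fun t => 0 + Complex.exp t).f w ∧
      AnalyticAt ℂ (F.pullback fun t => 0 + Complex.exp t).g w := by
  obtain ⟨h1, h2⟩ := hF _ (Complex.exp_ne_zero w) (mem_logDisc_iff.1 hw)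
  have he : AnalyticAt ℂ Complex.exp w := Complex.differentiable_exp.analyticAt w
  simp only [zero_add, pullback, Complex.deriv_exp]
  exact ⟨(he.mul (h1.fun_comp he)).sub (he.div he (Complex.exp_ne_zero w)),
    (he.pow 2).mul (h2.fun_comp he)⟩

theorem IsSolution.eq_zero {F : LinearODE} {r : ℝ} (hF : F.IsOrdinaryNear r) {Y : ℂ → ℂ}
    (hY : F.IsSolution 0 r Y) {w : ℂ} (hw : w ∈ logDisc r) (h0 : Y w = 0) (h1 : deriv Y w = 0) :
    ∀ t ∈ logDisc r, Y t = 0 := by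
  rw [isSolution_iff] at hY
  have ho := (isOpen_logDisc r).mem_nhds hw
  obtain ⟨hf, hg⟩ := hF.analyticAt_pullback_exp hw
  exact eqOn_zero_of_eventually hY.1 hw (eventually_eq_zero_of_solvesAt hf hg
    (hY.1.analyticAt ho) (by filter_upwards [ho] with t ht using hY.2 t ht) h0 h1)

theorem IsSolution.add {F : LinearODE} {a : ℂ} {r : ℝ} {U V : ℂ → ℂ} (hU : F.IsSolution a r U)
    (hV : F.IsSolution a r V) (s t : ℂ) : F.IsSolution a r (fun z => s * U z + t * V z) := by
  rw [isSolution_iff] at *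
  refine ⟨(hU.1.const_mul s).add (hV.1.const_mul t), fun w hw => ?_⟩
  have ho := (isOpen_logDisc r).mem_nhds hw
  exact ((hU.2 w hw).add (hU.1.analyticAt ho) (hV.1.analyticAt ho) (hV.2 w hw) s t).1

theorem IsSolution.deriv_add {F : LinearODE} {a : ℂ} {r : ℝ} {U V : ℂ → ℂ}
    (hU : F.IsSolution a r U) (hV : F.IsSolution a r V) (s t : ℂ) {w : ℂ} (hw : w ∈ logDisc r) :
    deriv (fun z => s * U z + t * V z) w = s * deriv U w + t * deriv V w := by
  rw [isSolution_iff] at *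
  have ho := (isOpen_logDisc r).mem_nhds hw
  exact ((hU.2 w hw).add (hU.1.analyticAt ho) (hV.1.analyticAt ho) (hV.2 w hw) s t).2

/-- The solution space is at most two-dimensional. -/
theorem IsSolution.exists_eq_add {F : LinearODE} {r : ℝ} (hr : 0 < r) (hF : F.IsOrdinaryNear r)
    {U V Y : ℂ → ℂ} (hU : F.IsSolution 0 r U) (hV : F.IsSolution 0 r V)
    (hY : F.IsSolution 0 r Y) (hi : Independent r U V) :
    ∃ s t : ℂ, ∀ w ∈ logDisc r, Y w = s * U w + t * V w := by
  obtain ⟨w, hw⟩ := exists_mem_logDisc hr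
  have key : ∀ s t : ℂ, s * U w + t * V w = 0 → s * deriv U w + t * deriv V w = 0 →
      s = 0 ∧ t = 0 := fun s t h0 h1 =>
    hi s t ((hU.add hV s t).eq_zero hF hw h0 (by rw [hU.deriv_add hV s t hw, h1]))
  -- If the Wronskian vanished at `w`, the relations with coefficients `(V, -U)` and `(V', -U')`
  -- would make `U, V, U', V'` all vanish there, contradicting independence.
  have hW : U w * deriv V w - deriv U w * V w ≠ 0 := by
    intro h
    obtain ⟨h1, h2⟩ := key (V w) (-U w) (by ring) (by linear_combination -h)
    rw [neg_eq_zero] at h2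
    obtain ⟨h3, h4⟩ := key (deriv V w) (-deriv U w) (by simp [h1, h2]) (by ring)
    rw [neg_eq_zero] at h4
    exact one_ne_zero (key 1 0 (by simp [h2]) (by simp [h4])).1
  set W := U w * deriv V w - deriv U w * V w with hWdef
  -- Cramer's rule, matching the value and derivative of `Y` at `w`.
  set s := (Y w * deriv V w - deriv Y w * V w) / W with hs
  set t := (U w * deriv Y w - deriv U w * Y w) / W with ht
  have hst := hU.add hV s t
  have h2 := (hY.add hst 1 (-1)).eq_zero hF hw
    (by simp only [hs, ht]; field_simp; rw [hWdef]; ring)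
    (by
      rw [hY.deriv_add hst 1 (-1) hw, hU.deriv_add hV s t hw]
      simp only [hs, ht]; field_simp; rw [hWdef]; ring)
  exact ⟨s, t, fun z hz => by linear_combination h2 z hz⟩

/-- The two scalar powers may be witnessed by different bases. Since every solution is a combination
of `U` and `V`, the `m`-th power is the scalar `c` on the other basis too, and one divides by it. -/
theorem MonodromyPowIsScalar.sub {F : LinearODE} {ρ : ℝ} (hρ : 0 < ρ) (hF : F.IsOrdinaryNear ρ)
    {m k : ℕ} (hm : F.MonodromyPowIsScalar 0 m) (hk : F.MonodromyPowIsScalar 0 (m + k)) :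
    F.MonodromyPowIsScalar 0 k := by
  obtain ⟨r₁, hr₁, U, V, hU, hV, hi, c, hc⟩ := hm
  obtain ⟨r₂, hr₂, U', V', hU', hV', hi', c', hc'⟩ := hk
  set r := min ρ (min r₁ r₂) with hrdef
  have hr : 0 < r := lt_min hρ (lt_min hr₁ hr₂)
  have h1 : r ≤ r₁ := (min_le_right _ _).trans (min_le_left _ _)
  have h2 : r ≤ r₂ := (min_le_right _ _).trans (min_le_right _ _)
  have hF' : F.IsOrdinaryNear r := fun s hs hs' => hF s hs (hs'.trans_le (min_le_left _ _))
  have hI : Independent r U V := Independent.mono hi hU.1 hV.1 hr h1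
  have hI' : Independent r U' V' := Independent.mono hi' hU'.1 hV'.1 hr h2
  -- With `c = 0`, `U` would vanish on a translate of the half-plane, hence identically.
  have hc0 : c ≠ 0 := by
    rintro rfl
    obtain ⟨w, hw⟩ := exists_mem_logDisc hr₁
    have hz : ∀ t ∈ logDisc r₁, U t = 0 := by
      refine eqOn_zero_of_eventually hU.1 (add_mem_logDisc hw m) ?_
      have hsub : Tendsto (fun t : ℂ => t - m * (2 * Real.pi * Complex.I))
          (𝓝 (w + m * (2 * Real.pi * Complex.I))) (𝓝 w) := by
        have := (continuous_sub_right (m * (2 * Real.pi * Complex.I) : ℂ)).tendsto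
            (w + m * (2 * Real.pi * Complex.I))
        simpa using this
      filter_upwards [hsub ((isOpen_logDisc r₁).mem_nhds hw)] with t ht
      have := (hc _ ht).1
      simpa using this
    exact one_ne_zero (hi 1 0 fun w hw => by simp [hz w hw]).1
  have hscal : ∀ Y, F.IsSolution 0 r Y → ∀ w ∈ logDisc r,
      Y (w + m * (2 * Real.pi * Complex.I)) = c * Y w := by
    intro Y hY w hw
    obtain ⟨s, t, hst⟩ := IsSolution.exists_eq_add hr hF' (hU.mono h1) (hV.mono h1) hY hI
    rw [hst w hw, hst _ (add_mem_logDisc hw m), (hc w (logDisc_mono h1 hw)).1,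
      (hc w (logDisc_mono h1 hw)).2]
    ring
  have hfin : ∀ Y, F.IsSolution 0 r Y → (∀ w ∈ logDisc r,
      Y (w + (m + k : ℕ) * (2 * Real.pi * Complex.I)) = c' * Y w) → ∀ w ∈ logDisc r,
      Y (w + k * (2 * Real.pi * Complex.I)) = c' / c * Y w := by
    intro Y hY hY' w hw
    have e1 := hscal Y hY _ (add_mem_logDisc hw k)
    have e2 := hY' w hw
    rw [show w + k * (2 * Real.pi * Complex.I) + m * (2 * Real.pi * Complex.I)
      = w + (m + k : ℕ) * (2 * Real.pi * Complex.I) by push_cast; ring, e2] at e1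
    rw [div_mul_eq_mul_div, eq_div_iff hc0]
    linear_combination -e1
  exact ⟨r, hr, U', V', hU'.mono h2, hV'.mono h2, hI', c' / c, fun w hw =>
    ⟨hfin U' (hU'.mono h2) (fun w hw => (hc' w (logDisc_mono h2 hw)).1) w hw,
      hfin V' (hV'.mono h2) (fun w hw => (hc' w (logDisc_mono h2 hw)).2) w hw⟩⟩

/-- The exponents with scalar monodromy are closed under subtraction, so the least one divides all
the others. -/
theorem exists_orderAt_dvd {F : LinearODE} {ρ : ℝ} (hρ : 0 < ρ) (hF : F.IsOrdinaryNear ρ) {n : ℕ}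
    (hn1 : 1 ≤ n) (hn : F.MonodromyPowIsScalar 0 n) :
    ∃ p : ℕ, F.orderAt 0 = p ∧ 1 ≤ p ∧ p ∣ n := by
  have hmem := csInf_mem (s := {m : ℕ∞ | ∃ n : ℕ, 1 ≤ n ∧ m = n ∧ F.MonodromyPowIsScalar 0 n})
    ⟨n, n, hn1, rfl, hn⟩
  obtain ⟨p, hp1, hp, hps⟩ := hmem
  refine ⟨p, hp, hp1, ?_⟩
  induction n using Nat.strong_induction_on with
  | _ n ih =>
    have hle : p ≤ n := by
      have : F.orderAt 0 ≤ n := sInf_le ⟨n, hn1, rfl, hn⟩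
      rw [orderAt, hp] at this
      exact_mod_cast this
    obtain ⟨k, rfl⟩ := Nat.exists_eq_add_of_le hle
    rcases Nat.eq_zero_or_pos k with rfl | hk
    · simp
    · exact dvd_add (dvd_refl p) (ih k (by omega) hk (hps.sub hρ hF hn))

theorem monodromyPowIsScalar_one {F : LinearODE} {a : ℂ} (h : F.orderAt a = 1) :
    F.MonodromyPowIsScalar a 1 := by
  have hne : {m : ℕ∞ | ∃ n : ℕ, 1 ≤ n ∧ m = n ∧ F.MonodromyPowIsScalar a n}.Nonempty := by
    by_contra hne
    rw [Set.not_nonempty_iff_eq_empty] at hne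
    rw [orderAt, hne, sInf_empty] at h
    exact absurd h (by simp)
  obtain ⟨p, -, hp, hps⟩ := csInf_mem hne
  rw [orderAt, hp] at h
  have : p = 1 := by exact_mod_cast h
  rwa [this] at hps

end LinearODE

/-! ### Descent of trivial monodromy along a ramified map -/

/-- A local inverse of `s ↦ s * (h s) ^ (1 / e)`, in logarithmic form. -/
theorem exists_log_inverse {e : ℕ} (he : 0 < e) {h : ℂ → ℂ} (ha : AnalyticAt ℂ h 0)
    (h0 : h 0 ≠ 0) : ∃ l : ℂ → ℂ, AnalyticAt ℂ l 0 ∧ ∀ᶠ t in 𝓝 (0 : ℂ),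
      (t * Complex.exp (l t)) ^ e * h (t * Complex.exp (l t)) = t ^ e := by
  have he0 : (e : ℂ) ≠ 0 := by exact_mod_cast he.ne'
  -- Dividing by `h 0` keeps the argument of `log` near `1`, away from the branch cut.
  set L : ℂ → ℂ := fun s => Complex.log (h s / h 0) + Complex.log (h 0) with hL
  have hLa : AnalyticAt ℂ L 0 := by
    refine AnalyticAt.add (AnalyticAt.clog (ha.div analyticAt_const h0) ?_) analyticAt_const
    simp [h0]
  have hLe : ∀ s, h s ≠ 0 → Complex.exp (L s) = h s := fun s hs => by
    rw [hL, Complex.exp_add, Complex.exp_log (div_ne_zero hs h0), Complex.exp_log h0,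
      div_mul_cancel₀ _ h0]
  set τ : ℂ → ℂ := fun s => s * Complex.exp (L s / e) with hτ
  have hEa : AnalyticAt ℂ (fun s => Complex.exp (L s / e)) 0 :=
    (hLa.div analyticAt_const he0).cexp
  have hτa : AnalyticAt ℂ τ 0 := analyticAt_id.mul hEa
  have hτ' : deriv τ 0 ≠ 0 := by
    have h1 := (hasDerivAt_id (0 : ℂ)).mul hEa.differentiableAt.hasDerivAt
    have h2 : deriv τ 0 = _ := h1.deriv
    rw [h2]
    simp
  have hτ0 : τ 0 = 0 := by simp [hτ]
  have hs := hτa.hasStrictDerivAt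
  set σ := hs.localInverse _ _ _ hτ' with hσ
  have hσa : AnalyticAt ℂ σ 0 := hτ0 ▸ hτa.analyticAt_localInverse hτ'
  have hσ0 : σ 0 = 0 := by
    have : σ (τ 0) = 0 := HasStrictFDerivAt.localInverse_apply_image ..
    rwa [hτ0] at this
  have hinv : ∀ᶠ t in 𝓝 (0 : ℂ), τ (σ t) = t := by
    have := hs.eventually_right_inverse hτ'
    rwa [hτ0] at this
  have hcomp : AnalyticAt ℂ (fun t => L (σ t)) 0 :=
    AnalyticAt.fun_comp (g := L) (by rwa [hσ0]) hσa
  have hne : ∀ᶠ t in 𝓝 (0 : ℂ), h (σ t) ≠ 0 := by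
    have : ContinuousAt (fun t => h (σ t)) 0 :=
      ContinuousAt.comp (g := h) (by rw [hσ0]; exact ha.continuousAt) hσa.continuousAt
    exact this.eventually_ne (by rwa [hσ0])
  -- The inverse `σ` of `s * exp (L s / e)` satisfies `σ t = t * exp (-L (σ t) / e)`.
  refine ⟨fun t => -(L (σ t) / e), (hcomp.div analyticAt_const he0).neg, ?_⟩
  filter_upwards [hinv, hne] with t ht hht
  have ht' : σ t * Complex.exp (L (σ t) / e) = t := ht
  have h1 : t * Complex.exp (-(L (σ t) / e)) = σ t := by
    nth_rewrite 1 [← ht']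
    rw [mul_assoc, ← Complex.exp_add, add_neg_cancel, Complex.exp_zero, mul_one]
  rw [h1]
  nth_rewrite 3 [← ht']
  rw [mul_pow, ← Complex.exp_nat_mul, mul_div_cancel₀ _ he0, hLe _ hht]

namespace LinearODE

/-- Trivial monodromy of a pull-back by `s ^ e * h s` descends to the `e`-th power. -/
theorem MonodromyPowIsScalar.of_pullback {F F' : LinearODE} {e : ℕ} (he : 0 < e) {h : ℂ → ℂ}
    (ha : AnalyticAt ℂ h 0) (h0 : h 0 ≠ 0)
    (hF : ∀ᶠ s in 𝓝[≠] (0 : ℂ), F'.AgreeAt (F.pullback fun s => s ^ e * h s) s)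
    (hF' : F'.MonodromyPowIsScalar 0 1) : F.MonodromyPowIsScalar 0 e := by
  obtain ⟨r, hr, U, V, hU, hV, hi, c, hc⟩ := hF'
  have he0 : (e : ℂ) ≠ 0 := by exact_mod_cast he.ne'
  set η : ℂ → ℂ := fun s => s ^ e * h s with hη
  obtain ⟨ε, hε, hball⟩ := Metric.eventually_nhds_iff.1 (eventually_nhdsWithin_iff.1
    (hF.and (eventually_pow_mul_ne_zero he ha h0)))
  set r₀ := min r ε with hr₀def
  have hr₀ : 0 < r₀ := lt_min hr hε
  obtain ⟨l, hl, hinv⟩ := exists_log_inverse he ha h0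
  have hsmall : ∀ᶠ t in 𝓝 (0 : ℂ), ‖t * Complex.exp (l t)‖ < r₀ := by
    have h1 : ContinuousAt (fun t : ℂ => ‖t * Complex.exp (l t)‖) 0 :=
      (continuousAt_id.mul hl.cexp.continuousAt).norm
    exact h1.eventually_lt_const (by simpa using hr₀)
  obtain ⟨δ, hδ, hδball⟩ := Metric.eventually_nhds_iff.1
    (hl.eventually_analyticAt.and (hinv.and hsmall))
  have hr₁ : 0 < δ ^ e := pow_pos hδ e
  -- A lift to the universal covers of an inverse branch of `η`: `η (exp (ψ w)) = exp w`. The radius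
  -- `δ ^ e` is what places `exp (w / e)` in the disc of radius `δ`.
  set ψ : ℂ → ℂ := fun w => w / e + l (Complex.exp (w / e)) with hψ
  have hroot : ∀ w ∈ logDisc (δ ^ e), ‖Complex.exp (w / e)‖ < δ := by
    intro w hw
    rw [mem_logDisc_iff] at hw
    refine lt_of_pow_lt_pow_left₀ e hδ.le ?_
    rwa [← norm_pow, ← Complex.exp_nat_mul, mul_div_cancel₀ _ he0]
  have hexp : ∀ w, Complex.exp (ψ w)
      = Complex.exp (w / e) * Complex.exp (l (Complex.exp (w / e))) := fun w => Complex.exp_add _ _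
  have hψmem : ∀ w ∈ logDisc (δ ^ e), ψ w ∈ logDisc r₀ := by
    intro w hw
    rw [mem_logDisc_iff, hexp]
    exact (hδball (by rw [dist_zero_right]; exact hroot w hw)).2.2
  have hηψ : ∀ w ∈ logDisc (δ ^ e), η (Complex.exp (ψ w)) = Complex.exp w := by
    intro w hw
    have := (hδball (y := Complex.exp (w / e)) (by rw [dist_zero_right]; exact hroot w hw)).2.1
    rw [hη, hexp]
    simp only []
    rw [this, ← Complex.exp_nat_mul, mul_div_cancel₀ _ he0]
  have hψa : ∀ w ∈ logDisc (δ ^ e), AnalyticAt ℂ ψ w := by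
    intro w hw
    have h1 := (hδball (y := Complex.exp (w / e)) (by rw [dist_zero_right]; exact hroot w hw)).1
    have h2 : AnalyticAt ℂ (fun w : ℂ => w / e) w := analyticAt_id.div analyticAt_const he0
    have h3 : AnalyticAt ℂ (fun w : ℂ => Complex.exp (w / e)) w :=
      (Complex.differentiable_exp.analyticAt _).fun_comp h2
    exact h2.add (AnalyticAt.fun_comp (g := l) h1 h3)
  have hηa : ∀ w ∈ logDisc r₀, AnalyticAt ℂ η (Complex.exp w) ∧ deriv η (Complex.exp w) ≠ 0 ∧
      F'.AgreeAt (F.pullback η) (Complex.exp w) := by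
    intro w hw
    rw [mem_logDisc_iff] at hw
    obtain ⟨h1, h2, -, -, -, h3⟩ := hball (y := Complex.exp w)
      (by rw [dist_zero_right]; exact hw.trans_le (min_le_right _ _)) (Complex.exp_ne_zero w)
    exact ⟨(analyticAt_id.pow e).mul h2, h3, h1⟩
  have hea : ∀ w, AnalyticAt ℂ Complex.exp w := fun w => Complex.differentiable_exp.analyticAt w
  have hζa : ∀ w ∈ logDisc r₀, AnalyticAt ℂ (fun t => η (Complex.exp t)) w ∧
      deriv (fun t => η (Complex.exp t)) w ≠ 0 := by
    intro w hw
    obtain ⟨h1, h2, -⟩ := hηa w hw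
    refine ⟨h1.fun_comp (hea w), ?_⟩
    rw [(deriv_comp_eventuallyEq h1 (hea w)).eq_of_nhds, Complex.deriv_exp]
    exact mul_ne_zero h2 (Complex.exp_ne_zero w)
  have hev : ∀ w ∈ logDisc (δ ^ e),
      (fun t => (fun t => η (Complex.exp t)) (ψ t)) =ᶠ[𝓝 w] fun t => 0 + Complex.exp t := by
    intro w hw
    filter_upwards [(isOpen_logDisc _).mem_nhds hw] with t ht
    rw [zero_add]
    exact hηψ t ht
  have hψ' : ∀ w ∈ logDisc (δ ^ e), deriv ψ w ≠ 0 := by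
    intro w hw hzero
    have h1 := (hev w hw).deriv_eq
    rw [(deriv_comp_eventuallyEq (hζa _ (hψmem w hw)).1 (hψa w hw)).eq_of_nhds, hzero, mul_zero,
      deriv_const_add, Complex.deriv_exp] at h1
    exact Complex.exp_ne_zero w h1.symm
  have hsol : ∀ Y, F'.IsSolution 0 r Y → F.IsSolution 0 (δ ^ e) fun w => Y (ψ w) := by
    intro Y hY
    have hY := hY.mono (min_le_left r ε)
    rw [isSolution_iff] at hY ⊢
    have hYa : ∀ w ∈ logDisc r₀, AnalyticAt ℂ Y w := fun w hw =>
      hY.1.analyticAt ((isOpen_logDisc r₀).mem_nhds hw)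
    refine ⟨fun w hw => ((hYa _ (hψmem w hw)).fun_comp
      (hψa w hw)).differentiableAt.differentiableWithinAt, fun w hw => ?_⟩
    obtain ⟨h1, h2, h3⟩ := hηa _ (hψmem w hw)
    have h4 : F'.AgreeAt (F.pullback η) (0 + Complex.exp (ψ w)) := by rwa [zero_add]
    have h5 := (h4.pullback (ψ := fun t => 0 + Complex.exp t)).solvesAt (hY.2 _ (hψmem w hw))
    simp only [zero_add] at h5
    have h6 := (F.pullback_pullback_agreeAt h1 (hea (ψ w)) h2
      (by rw [Complex.deriv_exp]; exact Complex.exp_ne_zero _)).solvesAt h5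
    have h7 := h6.comp (hYa _ (hψmem w hw)) (hψa w hw) (hψ' w hw)
    have h8 := (F.pullback_pullback_agreeAt (hζa _ (hψmem w hw)).1 (hψa w hw)
      (hζa _ (hψmem w hw)).2 (hψ' w hw)).solvesAt h7
    exact (F.agreeAt_pullback_of_eventuallyEq (hev w hw)).solvesAt h8
  -- Turning `e` times below lifts to turning once above, where the monodromy is scalar.
  have hmon : ∀ w, ψ (w + e * (2 * Real.pi * Complex.I))
      = ψ w + (1 : ℕ) * (2 * Real.pi * Complex.I) := by
    intro w
    have h1 : (w + e * (2 * Real.pi * Complex.I)) / e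
        = w / e + (1 : ℕ) * (2 * Real.pi * Complex.I) := by
      push_cast
      field_simp
    simp only [hψ]
    rw [h1, exp_add_mul_two_pi_I]
    ring
  refine ⟨δ ^ e, hr₁, _, _, hsol U hU, hsol V hV, fun s t hst => ?_, c, fun w hw => ?_⟩
  · refine hi s t ?_
    obtain ⟨w, hw⟩ := exists_mem_logDisc hr₁
    refine eqOn_zero_of_eventually ((hU.1.const_mul s).add (hV.1.const_mul t))
      (logDisc_mono (min_le_left r ε) (hψmem w hw)) ?_
    -- `ψ` is locally open, so a relation between the composites holds on a neighbourhood of `ψ w`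
    -- and then propagates.
    have hmap := (hψa w hw).hasStrictDerivAt.map_nhds_eq (hψ' w hw)
    rw [← hmap, eventually_map]
    filter_upwards [(isOpen_logDisc _).mem_nhds hw] with z hz using hst z hz
  · simp only [hmon]
    exact hc _ (logDisc_mono (min_le_left r ε) (hψmem w hw))

end LinearODE

/-! ### Regularity of the pulled-back projective structure -/

namespace LinearODE

/-- `h2` and `h1` say that the coefficients of `s⁻²` and `s⁻¹` in the normal form vanish. -/
theorem isRegularAt_zero_of_eventually_eq {F : LinearODE} {c C : ℂ} {m n : ℂ → ℂ}
    (hm : AnalyticAt ℂ m 0) (hn : AnalyticAt ℂ n 0)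
    (hf : ∀ᶠ s in 𝓝[≠] (0 : ℂ), F.f s = c / s + m s)
    (hg : ∀ᶠ s in 𝓝[≠] (0 : ℂ), F.g s = C / s ^ 2 + n s / s)
    (h2 : C + c / 2 - c ^ 2 / 4 = 0) (h1 : n 0 - c * m 0 / 2 = 0) : F.IsRegularAt 0 := by
  set N : ℂ → ℂ := fun s => n s - c * m s / 2 with hN
  have hNa : AnalyticAt ℂ N 0 := hn.sub ((analyticAt_const.mul hm).div analyticAt_const two_ne_zero)
  obtain ⟨P, hP⟩ := hNa
  have hD : AnalyticAt ℂ (dslope N 0) 0 := ⟨_, hP.has_fpower_series_dslope_fslope⟩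
  refine ⟨fun s => dslope N 0 s - deriv m s / 2 - m s ^ 2 / 4,
    (hD.sub (hm.deriv.div analyticAt_const two_ne_zero)).sub
      ((hm.pow 2).div analyticAt_const (by norm_num)), ?_⟩
  filter_upwards [self_mem_nhdsWithin, eventually_nhdsNE_eventually_nhds hf, hg,
    nhdsWithin_le_nhds hm.eventually_analyticAt] with s hs hfs hgs hms
  have hs : s ≠ 0 := hs
  have hd : deriv F.f s = -c / s ^ 2 + deriv m s := by
    have h3 : F.f =ᶠ[𝓝 s] fun s => c / s + m s := hfs
    rw [h3.deriv_eq]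
    have h4 : HasDerivAt (fun s : ℂ => c / s) (-c / s ^ 2) s := by
      refine (((hasDerivAt_inv hs).const_mul c).congr_deriv ?_).congr_of_eventuallyEq
        (Eventually.of_forall fun s => div_eq_mul_inv c s)
      field_simp
    exact (h4.add hms.differentiableAt.hasDerivAt).deriv
  have hsl : dslope N 0 s = N s / s := by
    have h0 : N 0 = 0 := h1
    rw [dslope_of_ne _ hs, slope_def_field, h0, sub_zero, sub_zero]
  rw [normalCoeff, hd, hfs.self_of_nhds, hgs, hsl]
  have h5 : C = c ^ 2 / 4 - c / 2 := by linear_combination h2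
  rw [h5, hN]
  field_simp
  ring

/-- Ramification `p` multiplies the exponent difference by `p`, up to `±1`, which kills the double
pole. The simple pole dies because, for `p ≥ 2`, the regular parts `u` and `v` contribute only terms
vanishing at `0`; the rest is a multiple of the same exponent relation. -/
theorem isRegularAt_zero_of_agreeAt_pullback {F F' : LinearODE} {p : ℕ} (hp : 2 ≤ p)
    {h u v : ℂ → ℂ} {a A : ℂ} (ha : AnalyticAt ℂ h 0) (h0 : h 0 ≠ 0) (hu : AnalyticAt ℂ u 0)
    (hv : AnalyticAt ℂ v 0) (hf : ∀ᶠ s in 𝓝[≠] (0 : ℂ), F.f s = a / s + u s)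
    (hg : ∀ᶠ s in 𝓝[≠] (0 : ℂ), F.g s = A / s ^ 2 + v s / s)
    (hθ : (a - 1) ^ 2 - 4 * A = (1 / (p : ℂ)) ^ 2)
    (hF : ∀ᶠ s in 𝓝[≠] (0 : ℂ), F'.AgreeAt (F.pullback fun s => s ^ p * h s) s) :
    F'.IsRegularAt 0 := by
  have hp0 : (p : ℂ) ≠ 0 := by
    have : p ≠ 0 := by omega
    exact_mod_cast this
  set η : ℂ → ℂ := fun s => s ^ p * h s with hη
  set k : ℂ → ℂ := fun s => p * h s + s * deriv h s with hk
  have hka : AnalyticAt ℂ k 0 :=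
    (analyticAt_const.mul ha).add (analyticAt_id.mul ha.deriv)
  have hk0 : k 0 ≠ 0 := by simp [hk, hp0, h0]
  have hηa : AnalyticAt ℂ η 0 := (analyticAt_id.pow p).mul ha
  have hη0 : η 0 = 0 := by
    have : p ≠ 0 := by omega
    simp [hη, this]
  have huη : AnalyticAt ℂ (fun s => u (η s)) 0 := AnalyticAt.fun_comp (by rwa [hη0]) hηa
  have hvη : AnalyticAt ℂ (fun s => v (η s)) 0 := AnalyticAt.fun_comp (by rwa [hη0]) hηa
  have hη_tendsto : Tendsto η (𝓝[≠] 0) (𝓝[≠] 0) := by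
    refine tendsto_nhdsWithin_iff.2 ⟨?_, ?_⟩
    · have := hηa.continuousAt.tendsto
      rw [hη0] at this
      exact this.mono_left nhdsWithin_le_nhds
    · filter_upwards [eventually_pow_mul_ne_zero (e := p) (by omega) ha h0] with s hs using hs.2.2.1
  obtain ⟨j, rfl⟩ := Nat.exists_eq_add_of_le hp
  -- Here `p = 2 + j` and `η' = s ^ (j + 1) * k`; the coefficients of the pull-back are expanded as
  -- polar part plus holomorphic part.
  set m : ℂ → ℂ := fun s => a * (deriv h s / h s) + s ^ (j + 1) * k s * u (η s)
    - deriv k s / k s with hm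
  set n : ℂ → ℂ := fun s => 2 * A * (2 + j : ℕ) * (deriv h s / h s)
    + s * (A * (deriv h s / h s) ^ 2 + s ^ j * k s ^ 2 * v (η s) / h s) with hn
  have hlog := ha.deriv.div ha h0
  have hma : AnalyticAt ℂ m 0 := ((analyticAt_const.mul hlog).add
    (((analyticAt_id.pow (j + 1)).mul hka).mul huη)).sub (hka.deriv.div hka hk0)
  have hna : AnalyticAt ℂ n 0 := (analyticAt_const.mul hlog).add (analyticAt_id.mul
    ((analyticAt_const.mul (hlog.pow 2)).add
      ((((analyticAt_id.pow j).mul (hka.pow 2)).mul hvη).div ha h0)))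
  have hk' : deriv k 0 = ((2 + j : ℕ) + 1) * deriv h 0 := by
    have h1 := (ha.differentiableAt.hasDerivAt.const_mul ((2 + j : ℕ) : ℂ)).add
      ((hasDerivAt_id (0 : ℂ)).mul ha.deriv.differentiableAt.hasDerivAt)
    refine h1.deriv.trans ?_
    simp
    ring
  have hcoef : ∀ᶠ s in 𝓝[≠] (0 : ℂ),
      F'.f s = (a * (2 + j : ℕ) - (2 + j : ℕ) + 1) / s + m s ∧
      F'.g s = A * (2 + j : ℕ) ^ 2 / s ^ 2 + n s / s := by
    filter_upwards [self_mem_nhdsWithin, hF,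
      eventually_nhdsNE_eventually_nhds (nhdsWithin_le_nhds ha.eventually_analyticAt),
      eventually_pow_mul_ne_zero (e := 2 + j) (by omega) ha h0,
      nhdsWithin_le_nhds hka.eventually_analyticAt, hη_tendsto.eventually hf,
      hη_tendsto.eventually hg] with s hs hFs has hηs hks hfs hgs
    have hs : s ≠ 0 := hs
    obtain ⟨-, hhs, -, hk1, -⟩ := hηs
    have hk1 : k s ≠ 0 := hk1
    have d1 : deriv η =ᶠ[𝓝 s] fun t => t ^ (j + 1) * k t := by
      filter_upwards [has] with t ht
      rw [hη, deriv_pow_mul (by omega) ht, show 2 + j - 1 = j + 1 by omega]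
    have d2 : deriv (deriv η) s = s ^ j * ((j + 1 : ℕ) * k s + s * deriv k s) := by
      rw [d1.deriv_eq, deriv_pow_mul (by omega) hks]
      rfl
    have hkd : s * deriv h s = k s - (2 + j : ℕ) * h s := by
      simp only [hk]
      ring
    have hld : deriv h s / h s = (k s / h s - (2 + j : ℕ)) / s := by
      field_simp
      linear_combination hkd
    have hηv : η s = s ^ (2 + j) * h s := rfl
    rw [hFs.1, hFs.2]
    simp only [LinearODE.pullback, hfs, hgs, d1.eq_of_nhds, d2, hm, hn, hld]
    generalize u (η s) = us
    generalize v (η s) = vs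
    rw [hηv]
    generalize deriv k s = k'
    generalize k s = ks at *
    generalize h s = hs' at *
    constructor
    · push_cast
      field_simp
      ring
    · push_cast
      field_simp
      ring
  refine isRegularAt_zero_of_eventually_eq hma hna (hcoef.mono fun s hs => hs.1)
    (hcoef.mono fun s hs => hs.2) ?_ ?_
  · field_simp at hθ
    linear_combination (-1 / 4) * hθ
  · have hk00 : k 0 = (2 + j : ℕ) * h 0 := by simp [hk]
    have hm0 : m 0 = a * (deriv h 0 / h 0) - deriv k 0 / k 0 := by simp [hm]
    have hn0 : n 0 = 2 * A * (2 + j : ℕ) * (deriv h 0 / h 0) := by simp [hn]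
    rw [hm0, hn0, hk', hk00]
    field_simp
    field_simp at hθ
    linear_combination (-deriv h 0) * hθ

theorem isRegularAt_zero_of_agreeAt_pullback_of_analyticAt {F F' : LinearODE} {h : ℂ → ℂ}
    (ha : AnalyticAt ℂ h 0) (h0 : h 0 ≠ 0) (hf : AnalyticAt ℂ F.f 0) (hg : AnalyticAt ℂ F.g 0)
    (hF : ∀ᶠ s in 𝓝[≠] (0 : ℂ), F'.AgreeAt (F.pullback fun s => s ^ 1 * h s) s) :
    F'.IsRegularAt 0 := by
  set η : ℂ → ℂ := fun s => s ^ 1 * h s with hη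
  have hηa : AnalyticAt ℂ η 0 := (analyticAt_id.pow 1).mul ha
  have hη0 : η 0 = 0 := by simp [hη]
  have hη' : deriv η 0 ≠ 0 := by
    rw [hη, deriv_pow_mul one_pos ha]
    simpa using h0
  have h1 : AnalyticAt ℂ (F.pullback η).f 0 :=
    (hηa.deriv.mul (AnalyticAt.fun_comp (by rwa [hη0]) hηa)).sub (hηa.deriv.deriv.div hηa.deriv hη')
  have h2 : AnalyticAt ℂ (F.pullback η).g 0 :=
    (hηa.deriv.pow 2).mul (AnalyticAt.fun_comp (by rwa [hη0]) hηa)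
  refine isRegularAt_zero_of_eventually_eq (c := 0) (C := 0) h1
    (analyticAt_id.mul h2) (hF.mono fun s hs => by simp [hs.1]) ?_ (by simp) (by simp)
  filter_upwards [hF, self_mem_nhdsWithin] with s hs hs0
  have hs0 : s ≠ 0 := hs0
  simp [hs.2, hs0]

/-- A regular singular point at `0` with residues `a` and `A`, and no other singular point in the
unit disc. -/
def HasRegularForm (F : LinearODE) (a A : ℂ) : Prop :=
  ∃ u v : ℂ → ℂ, (∀ t : ℂ, ‖t‖ < 1 → AnalyticAt ℂ u t ∧ AnalyticAt ℂ v t) ∧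
    ∀ t : ℂ, t ≠ 0 → ‖t‖ < 1 → F.f t = a / t + u t ∧ F.g t = A / t ^ 2 + v t / t

theorem HasRegularForm.isOrdinaryNear {F : LinearODE} {a A : ℂ} (h : F.HasRegularForm a A) :
    F.IsOrdinaryNear 1 := by
  obtain ⟨u, v, huv, hF⟩ := h
  intro s hs hs1
  have hev : ∀ᶠ t in 𝓝 s, t ≠ 0 ∧ ‖t‖ < 1 :=
    (eventually_ne_nhds hs).and (continuous_norm.continuousAt.eventually_lt_const hs1)
  obtain ⟨hu, hv⟩ := huv s hs1
  constructor
  · refine AnalyticAt.congr ((analyticAt_const.div analyticAt_id hs).add hu)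
      (hev.mono fun t ht => (hF t ht.1 ht.2).1.symm)
  · refine AnalyticAt.congr ((analyticAt_const.div (analyticAt_id.pow 2) (pow_ne_zero 2 hs)).add
      (hv.div analyticAt_id hs)) (hev.mono fun t ht => (hF t ht.1 ht.2).2.symm)

end LinearODE

/-! ### Local forms of the hypergeometric equation -/

namespace RiemannScheme

open LinearODE

theorem hasRegularForm_zero (S : RiemannScheme) :
    (S.equation.pullback (chart ((0 : ℂ) : OnePoint ℂ))).HasRegularForm (1 - S.α₁ - S.α₂)
      (S.α₁ * S.α₂) := by
  have hne : ∀ t : ℂ, ‖t‖ < 1 → t - 1 ≠ 0 := fun t ht h => by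
    rw [sub_eq_zero.1 h, norm_one] at ht
    exact lt_irrefl _ ht
  refine ⟨fun t => (1 - S.β₁ - S.β₂) / (t - 1), fun t => t * (S.β₁ * S.β₂) / (t - 1) ^ 2
    + (S.γ₁ * S.γ₂ - S.α₁ * S.α₂ - S.β₁ * S.β₂) / (t - 1), fun t ht => ?_, fun t ht0 ht => ?_⟩
  · have h1 : AnalyticAt ℂ (fun t : ℂ => t - 1) t := analyticAt_id.sub analyticAt_const
    exact ⟨analyticAt_const.div h1 (hne t ht), ((analyticAt_id.mul analyticAt_const).div
      (h1.pow 2) (pow_ne_zero 2 (hne t ht))).add (analyticAt_const.div h1 (hne t ht))⟩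
  · have := hne t ht
    rw [pullback_chart_coe]
    simp only [equation, zero_add]
    refine ⟨trivial, ?_⟩
    field_simp
    ring

theorem hasRegularForm_one (S : RiemannScheme) :
    (S.equation.pullback (chart ((1 : ℂ) : OnePoint ℂ))).HasRegularForm (1 - S.β₁ - S.β₂)
      (S.β₁ * S.β₂) := by
  have hne : ∀ t : ℂ, ‖t‖ < 1 → 1 + t ≠ 0 := fun t ht h => by
    rw [← neg_eq_iff_add_eq_zero.2 h, norm_neg, norm_one] at ht
    exact lt_irrefl _ ht
  refine ⟨fun t => (1 - S.α₁ - S.α₂) / (1 + t), fun t => t * (S.α₁ * S.α₂) / (1 + t) ^ 2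
    + (S.γ₁ * S.γ₂ - S.α₁ * S.α₂ - S.β₁ * S.β₂) / (1 + t), fun t ht => ?_, fun t ht0 ht => ?_⟩
  · have h1 : AnalyticAt ℂ (fun t : ℂ => 1 + t) t := analyticAt_const.add analyticAt_id
    exact ⟨analyticAt_const.div h1 (hne t ht), ((analyticAt_id.mul analyticAt_const).div
      (h1.pow 2) (pow_ne_zero 2 (hne t ht))).add (analyticAt_const.div h1 (hne t ht))⟩
  · have := hne t ht
    rw [pullback_chart_coe]
    simp only [equation, add_sub_cancel_left]
    refine ⟨by ring, ?_⟩
    field_simp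
    ring

theorem hasRegularForm_infty (S : RiemannScheme) :
    (S.equation.pullback (chart OnePoint.infty)).HasRegularForm (1 - S.γ₁ - S.γ₂)
      (S.γ₁ * S.γ₂) := by
  have hne : ∀ t : ℂ, ‖t‖ < 1 → 1 - t ≠ 0 := fun t ht h => by
    rw [← sub_eq_zero.1 h, norm_one] at ht
    exact lt_irrefl _ ht
  refine ⟨fun t => -(1 - S.β₁ - S.β₂) / (1 - t), fun t => S.β₁ * S.β₂ * (2 - t) / (1 - t) ^ 2
    + (S.γ₁ * S.γ₂ - S.α₁ * S.α₂ - S.β₁ * S.β₂) / (1 - t), fun t ht => ?_, fun t ht0 ht => ?_⟩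
  · have h1 : AnalyticAt ℂ (fun t : ℂ => 1 - t) t := analyticAt_const.sub analyticAt_id
    exact ⟨analyticAt_const.div h1 (hne t ht), ((analyticAt_const.mul
      (analyticAt_const.sub analyticAt_id)).div
      (h1.pow 2) (pow_ne_zero 2 (hne t ht))).add (analyticAt_const.div h1 (hne t ht))⟩
  · have h1 := hne t ht
    have d1 : deriv (fun s : ℂ => s⁻¹) = fun s => -(s ^ 2)⁻¹ := deriv_inv'
    have d2 : deriv (fun s : ℂ => -(s ^ 2)⁻¹) t = 2 / t ^ 3 := by
      have := ((hasDerivAt_pow 2 t).inv (pow_ne_zero 2 ht0)).neg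
      refine this.deriv.trans ?_
      field_simp
      push_cast
      ring
    have h2 : t⁻¹ - 1 = (1 - t) / t := by field_simp
    -- In the coordinate `1/z` the residue of the first coefficient is the sum of the exponents at
    -- `0` and `1`; the relation of Fuchs turns it into `1 - γ₁ - γ₂`.
    have hΓ : S.α₁ + S.α₂ + S.β₁ + S.β₂ = 1 - S.γ₁ - S.γ₂ := by linear_combination S.fuchs
    simp only [pullback, chart_infty, d1, d2, equation, h2, ← hΓ]
    constructor
    · field_simp
      ring
    · field_simp
      ring

theorem analyticAt_equation (S : RiemannScheme) {c : ℂ} (h0 : c ≠ 0) (h1 : c ≠ 1) :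
    AnalyticAt ℂ S.equation.f c ∧ AnalyticAt ℂ S.equation.g c := by
  have e1 : AnalyticAt ℂ (fun z : ℂ => z - 1) c := analyticAt_id.sub analyticAt_const
  have h1 : c - 1 ≠ 0 := sub_ne_zero.2 h1
  refine ⟨(analyticAt_const.div analyticAt_id h0).add (analyticAt_const.div e1 h1), ?_⟩
  exact ((analyticAt_const.div (analyticAt_id.pow 2) (pow_ne_zero 2 h0)).add
    (analyticAt_const.div (e1.pow 2) (pow_ne_zero 2 h1))).add
    (analyticAt_const.div (analyticAt_id.mul e1) (mul_ne_zero h0 h1))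

end RiemannScheme

/-! ### Constraints on the ramification index -/

namespace LinearODE

theorem one_le_order (E : LinearODE) (x : OnePoint ℂ) : 1 ≤ E.order x := by
  rw [order_eq_orderAt]
  refine le_sInf ?_
  rintro _ ⟨n, hn, rfl, -⟩
  exact_mod_cast hn

/-- If the monodromy of the pull-back is trivial at `x`, then the order of the monodromy at `φ x`
divides the ramification index. -/
theorem exists_order_dvd_ram {φ : RatFunc ℂ} (hd : 1 ≤ degree φ) {E : LinearODE}
    {x : OnePoint ℂ} {a A : ℂ} (hE : (E.pullback (chart (toMap φ x))).HasRegularForm a A)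
    (hx : (E.pullback (affineFun φ)).order x = 1) :
    ∃ p : ℕ, E.order (toMap φ x) = p ∧ 1 ≤ p ∧ p ∣ ram φ x := by
  obtain ⟨h, ha, h0, hh⟩ := exists_pullback_local_form hd E x
  rw [order_eq_orderAt] at hx
  rw [order_eq_orderAt]
  exact exists_orderAt_dvd one_pos hE.isOrdinaryNear (ram_pos hd x)
    (MonodromyPowIsScalar.of_pullback (ram_pos hd x) ha h0 hh (monodromyPowIsScalar_one hx))

/-- At a point over a pole with exponent difference `1 / p`, a singular point with trivial monodromy
has ramification index at least `2 * p`. -/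
theorem two_mul_le_ram {φ : RatFunc ℂ} (hd : 1 ≤ degree φ) {E : LinearODE} {x : OnePoint ℂ}
    {a A : ℂ} (hE : (E.pullback (chart (toMap φ x))).HasRegularForm a A) {p : ℕ} (hp : 2 ≤ p)
    (hθ : (a - 1) ^ 2 - 4 * A = (1 / (p : ℂ)) ^ 2) (hdvd : p ∣ ram φ x)
    (hx : ¬ (E.pullback (affineFun φ)).IsRegular x) : 2 * p ≤ ram φ x := by
  obtain ⟨h, ha, h0, hh⟩ := exists_pullback_local_form hd E x
  obtain ⟨k, hk⟩ := hdvd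
  have hr := ram_pos hd x
  have hk0 : k ≠ 0 := by
    rintro rfl
    omega
  have hk1 : k ≠ 1 := by
    rintro rfl
    rw [hk, mul_one] at hh
    obtain ⟨u, v, huv, hF⟩ := hE
    obtain ⟨hu, hv⟩ := huv 0 (by simp)
    have hne : ∀ᶠ t in 𝓝[≠] (0 : ℂ), t ≠ 0 := self_mem_nhdsWithin
    have hev : ∀ᶠ t in 𝓝[≠] (0 : ℂ), t ≠ 0 ∧ ‖t‖ < 1 := hne.and
      (nhdsWithin_le_nhds (continuous_norm.continuousAt.eventually_lt_const (by simp)))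
    exact hx (isRegular_of_isRegularAt _ x (isRegularAt_zero_of_agreeAt_pullback hp ha h0 hu hv
      (hev.mono fun t ht => (hF t ht.1 ht.2).1) (hev.mono fun t ht => (hF t ht.1 ht.2).2) hθ hh))
  rw [hk, mul_comm]
  exact Nat.mul_le_mul_left p (by omega)

/-- Outside the fibres over the poles, singular points of the pull-back are ramified. -/
theorem two_le_ram {φ : RatFunc ℂ} (hd : 1 ≤ degree φ) (S : RiemannScheme) {x : OnePoint ℂ}
    (hpole : toMap φ x ∉ poles) (hx : ¬ (S.equation.pullback (affineFun φ)).IsRegular x) :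
    2 ≤ ram φ x := by
  obtain ⟨h, ha, h0, hh⟩ := exists_pullback_local_form hd S.equation x
  have hr := ram_pos hd x
  by_contra hlt
  have h1 : ram φ x = 1 := by omega
  rw [h1] at hh
  refine hx (isRegular_of_isRegularAt _ x ?_)
  generalize toMap φ x = c at *
  induction c using OnePoint.rec with
  | infty => exact absurd (by simp [poles]) hpole
  | coe c =>
    have hc : c ≠ 0 ∧ c ≠ 1 := by
      constructor <;> rintro rfl <;> exact hpole (by simp [poles])
    obtain ⟨hf, hg⟩ := S.analyticAt_equation hc.1 hc.2
    have e1 : AnalyticAt ℂ (fun s : ℂ => c + s) 0 := analyticAt_const.add analyticAt_id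
    refine isRegularAt_zero_of_agreeAt_pullback_of_analyticAt ha h0 ?_ ?_ hh
    · rw [pullback_chart_coe]
      exact AnalyticAt.fun_comp (g := S.equation.f) (f := fun s => c + s) (by simpa using hf) e1
    · rw [pullback_chart_coe]
      exact AnalyticAt.fun_comp (g := S.equation.g) (f := fun s => c + s) (by simpa using hg) e1

end LinearODE

/-! ### Weights `1 / p` and the final arithmetic -/

theorem recip_natCast (n : ℕ) : recip (n : ℕ∞) = 1 / (n : ℝ) := rfl

theorem recip_top : recip ⊤ = 0 := rfl

theorem recip_nonneg (p : ℕ∞) : 0 ≤ recip p := by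
  induction p using ENat.recTopCoe with
  | top => exact le_rfl
  | coe n => rw [recip_natCast]; positivity

theorem recip_le_recip {p q : ℕ∞} (hp : 1 ≤ p) (h : p ≤ q) : recip q ≤ recip p := by
  induction q using ENat.recTopCoe with
  | top => rw [recip_top]; exact recip_nonneg p
  | coe n =>
    induction p using ENat.recTopCoe with
    | top => simp at h
    | coe m =>
      have hm : 1 ≤ m := by exact_mod_cast hp
      have hmn : m ≤ n := by exact_mod_cast h
      rw [recip_natCast, recip_natCast]
      exact one_div_le_one_div_of_le (by exact_mod_cast hm) (by exact_mod_cast hmn)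

/-- Each point has weight `q * e x`: at least `1` on `T`, `2` on `M`, and `q'` off `T`. -/
theorem card_add_card_add_mul_card_le {α : Type*} (s : Finset α) (e : α → ℕ) {q q' : ℝ}
    (T M : α → Prop) [DecidablePred T] [DecidablePred M] (hq : q' ≤ q) (hq' : 0 ≤ q')
    (he : ∀ x ∈ s, 1 ≤ e x) (hT : ∀ x ∈ s, T x → 1 ≤ q * e x)
    (hM : ∀ x ∈ s, M x → T x ∧ 2 ≤ q * e x) :
    ((s.filter T).card : ℝ) + (s.filter M).card + q' * (s.filter fun x => ¬ T x).card
      ≤ (∑ x ∈ s, e x : ℕ) * q := by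
  rw [Finset.card_filter, Finset.card_filter, Finset.card_filter]
  push_cast
  rw [Finset.mul_sum, ← Finset.sum_add_distrib, ← Finset.sum_add_distrib, Finset.sum_mul]
  refine Finset.sum_le_sum fun x hx => ?_
  have h1 := he x hx
  have h2 := hT x hx
  have h3 := hM x hx
  by_cases hTx : T x
  · by_cases hMx : M x
    · have := (h3 hMx).2
      simp only [hTx, hMx, if_true, not_true, if_false]
      linarith
    · have := h2 hTx
      simp only [hTx, hMx, if_true, not_true, if_false]
      linarith
  · have hMx : ¬ M x := fun h => hTx (h3 h).1
    have h4 : (1 : ℝ) ≤ e x := by exact_mod_cast h1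
    simp only [hTx, hMx, not_false_eq_true, if_true, if_false]
    nlinarith

/-- The numerical consequences of the count of singular points. -/
theorem arithmetic_of_fibre_bounds {d : ℕ} {p0 p1 pinf : ℕ∞}
    (hyp : recip p0 + recip p1 + recip pinf < 1) (hpinf : 1 ≤ pinf) (hdpos : 1 ≤ d)
    {n0 n1 n2 b0 b1 b2 : ℕ}
    (h0 : (n0 : ℝ) + recip pinf * b0 ≤ d * recip p0)
    (h1 : (n1 : ℝ) + recip pinf * b1 ≤ d * recip p1)
    (h2 : (n2 : ℝ) + recip pinf * b2 ≤ d * recip pinf)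
    (hb : b0 + b1 + b2 ≤ 6) (hn : d + 5 ≤ n0 + n1 + n2 + (b0 + b1 + b2)) :
    ((d : ℤ) - (⌊(d : ℝ) * recip p0⌋ + ⌊(d : ℝ) * recip p1⌋ + ⌊(d : ℝ) * recip pinf⌋) = 1) ∧
    ((1 - recip p0 - recip p1 - recip pinf) * (d : ℝ) ≤ 1 - 6 * recip pinf) ∧
    ((d : ℕ∞) < pinf → 1 ≤ 1 / (d : ℝ) + recip p0 + recip p1) ∧
    (pinf ≤ (d : ℕ∞) →
      (1 - recip p0 - recip p1) * (pinf.toNat : ℝ) ^ 2 - 2 * (pinf.toNat : ℝ) + 6 ≤ 0 ∧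
      5 / 6 ≤ recip p0 + recip p1 ∧ recip p0 + recip p1 < 1) := by
  have hq := recip_nonneg pinf
  have hd0 : (0 : ℝ) < d := by exact_mod_cast hdpos
  have hbq : ∀ b : ℕ, 0 ≤ recip pinf * b := fun b => mul_nonneg hq b.cast_nonneg
  have hlt : (d : ℝ) * recip p0 + d * recip p1 + d * recip pinf < d := by nlinarith
  -- Hyperbolicity gives strictness; with `hb` and `hn` it leaves only `∑ n = d - 1` and `∑ b = 6`.
  have hNlt : n0 + n1 + n2 < d := by
    have : (n0 : ℝ) + n1 + n2 < d := by linarith [hbq b0, hbq b1, hbq b2]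
    exact_mod_cast this
  have hb6 : b0 + b1 + b2 = 6 := by omega
  have hN : n0 + n1 + n2 + 1 = d := by omega
  have hbR : (b0 : ℝ) + b1 + b2 = 6 := by exact_mod_cast hb6
  have hNR : (n0 : ℝ) + n1 + n2 + 1 = d := by exact_mod_cast hN
  have hfloor : ∀ {n b : ℕ} {q : ℝ}, (n : ℝ) + recip pinf * b ≤ d * q →
      (n : ℤ) ≤ ⌊(d : ℝ) * q⌋ := fun {n b q} h => by
    rw [Int.le_floor]
    push_cast
    linarith [hbq b]
  have f0 := hfloor h0
  have f1 := hfloor h1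
  have f2 := hfloor h2
  have hone : (d : ℤ) - (⌊(d : ℝ) * recip p0⌋ + ⌊(d : ℝ) * recip p1⌋ + ⌊(d : ℝ) * recip pinf⌋)
      = 1 := by
    have hlt' : ⌊(d : ℝ) * recip p0⌋ + ⌊(d : ℝ) * recip p1⌋ + ⌊(d : ℝ) * recip pinf⌋ < (d : ℤ) := by
      have : ((⌊(d : ℝ) * recip p0⌋ + ⌊(d : ℝ) * recip p1⌋ + ⌊(d : ℝ) * recip pinf⌋ : ℤ) : ℝ)
          < ((d : ℤ) : ℝ) := by
        push_cast
        linarith [Int.floor_le ((d : ℝ) * recip p0), Int.floor_le ((d : ℝ) * recip p1),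
          Int.floor_le ((d : ℝ) * recip pinf)]
      exact_mod_cast this
    omega
  have htwo : (1 - recip p0 - recip p1 - recip pinf) * (d : ℝ) ≤ 1 - 6 * recip pinf := by
    have : recip pinf * b0 + recip pinf * b1 + recip pinf * b2 = 6 * recip pinf := by
      rw [← mul_add, ← mul_add, hbR, mul_comm]
    linarith
  refine ⟨hone, htwo, fun hdp => ?_, fun hpd => ?_⟩
  -- For `d < p_∞` the third fibre has `n2 = 0`, so `d - 1 = n0 + n1 ≤ d / p0 + d / p1`.
  · have hzero : ⌊(d : ℝ) * recip pinf⌋ = 0 := by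
      rw [Int.floor_eq_zero_iff]
      refine ⟨mul_nonneg hd0.le hq, ?_⟩
      induction pinf using ENat.recTopCoe with
      | top => simp [recip_top]
      | coe n =>
        have hdn : (d : ℝ) < n := by exact_mod_cast hdp
        rw [recip_natCast, mul_one_div, div_lt_one (hd0.trans hdn)]
        exact hdn
    have hn2 : n2 = 0 := by omega
    have h3 : (d : ℝ) ≤ 1 + d * recip p0 + d * recip p1 := by
      rw [hn2] at hNR
      push_cast at hNR
      linarith [hbq b0, hbq b1]
    have h4 : (1 / (d : ℝ) + recip p0 + recip p1) * d = 1 + d * recip p0 + d * recip p1 := by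
      field_simp
    nlinarith
  · induction pinf using ENat.recTopCoe with
    | top => simp at hpd
    | coe n =>
      have hn1 : (1 : ℝ) ≤ n := by exact_mod_cast hpinf
      have hn0 : (0 : ℝ) < n := by linarith
      have hnd : (n : ℝ) ≤ d := by exact_mod_cast hpd
      rw [recip_natCast] at hyp htwo
      rw [ENat.toNat_natCast]
      set t := 1 - recip p0 - recip p1 with ht
      have ht1 : 1 < t * n := by
        have : 1 / (n : ℝ) < t := by linarith
        rwa [div_lt_iff₀ hn0] at this
      have h3 : (t * n - 1) * d ≤ n - 6 := by
        have h4 := mul_le_mul_of_nonneg_left htwo hn0.le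
        have h5 : (n : ℝ) * ((t - 1 / n) * d) = (t * n - 1) * d := by field_simp
        have h6 : (n : ℝ) * (1 - 6 * (1 / n)) = n - 6 := by field_simp
        linarith
      have h4 : (t * n - 1) * n ≤ (t * n - 1) * d := by nlinarith
      have h5 : t * (n : ℝ) ^ 2 - 2 * n + 6 ≤ 0 := by nlinarith
      have htpos : 0 < t := by nlinarith
      refine ⟨h5, ?_, by linarith⟩
      -- The left side is `(t * n - 1) ^ 2 + 6 * t - 1`, whence `t ≤ 1 / 6`.
      have h6 : t * (t * (n : ℝ) ^ 2 - 2 * n + 6) ≤ 0 := mul_nonpos_of_nonneg_of_nonpos htpos.le h5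
      nlinarith [sq_nonneg (t * n - 1)]

/-! ### Counting points over the poles -/

open Finset

open Classical in
theorem exists_fibre_bound {φ : RatFunc ℂ} (hd : 1 ≤ degree φ) {E : LinearODE} {c : OnePoint ℂ}
    {a A : ℂ} (hE : (E.pullback (chart c)).HasRegularForm a A) {q' : ℝ} (hq' : 0 ≤ q')
    (hq : q' ≤ recip (E.order c)) (hc : recip (E.order c) < 1) (M : OnePoint ℂ → Prop)
    (hM : ∀ x, M x → (E.pullback (affineFun φ)).IsApparentSingularity x ∧
      ∀ n : ℕ, E.order c = n → (a - 1) ^ 2 - 4 * A = (1 / (n : ℂ)) ^ 2) :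
    ∃ s : Finset (OnePoint ℂ), (∀ x, x ∈ s ↔ toMap φ x = c) ∧ ∑ x ∈ s, ram φ x = degree φ ∧
      (((s.filter fun x => (E.pullback (affineFun φ)).order x = 1).card
        + (s.filter M).card : ℕ) : ℝ)
        + q' * (s.filter fun x => ¬ (E.pullback (affineFun φ)).order x = 1).card
        ≤ degree φ * recip (E.order c) := by
  obtain ⟨s, hs, hsum⟩ := exists_fibre hd c
  refine ⟨s, hs, hsum, ?_⟩
  have key : ∀ x ∈ s, (E.pullback (affineFun φ)).order x = 1 →
      ∃ p : ℕ, E.order c = p ∧ 2 ≤ p ∧ p ∣ ram φ x := by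
    intro x hx hx1
    rw [hs] at hx
    subst hx
    obtain ⟨p, hp, hp1, hdvd⟩ := LinearODE.exists_order_dvd_ram hd hE hx1
    refine ⟨p, hp, ?_, hdvd⟩
    -- Order `1` would give weight `1`, excluded by `hc`.
    by_contra hlt
    have : p = 1 := by omega
    rw [hp, this, recip_natCast] at hc
    norm_num at hc
  have hmul : ∀ {p k e : ℕ}, 2 ≤ p → k * p ≤ e → (k : ℝ) ≤ recip (p : ℕ∞) * e := by
    intro p k e hp h
    have hp0 : (0 : ℝ) < p := by exact_mod_cast (by omega : 0 < p)
    rw [recip_natCast, one_div_mul_eq_div, le_div_iff₀ hp0]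
    exact_mod_cast h
  have h := card_add_card_add_mul_card_le s (ram φ) (q := recip (E.order c)) (q' := q')
    (fun x => (E.pullback (affineFun φ)).order x = 1) M hq hq' (fun x _ => ram_pos hd x)
    (fun x hx hx1 => ?_) (fun x hx hMx => ?_)
  · rw [hsum] at h
    push_cast
    exact h
  · obtain ⟨p, hp, hp2, hdvd⟩ := key x hx hx1
    rw [hp]
    have := hmul (k := 1) hp2 (by simpa using Nat.le_of_dvd (ram_pos hd x) hdvd)
    simpa using this
  · obtain ⟨⟨hreg, hx1⟩, hθ⟩ := hM x hMx
    obtain ⟨p, hp, hp2, hdvd⟩ := key x hx hx1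
    refine ⟨hx1, ?_⟩
    have hθp := hθ p hp
    rw [hs] at hx
    subst hx
    rw [hp]
    have := hmul (k := 2) hp2 (LinearODE.two_mul_le_ram hd hE hp2 hθp hdvd hreg)
    simpa using this

open Classical in
/-- The count of Riemann and Hurwitz over three points. -/
theorem degree_add_card_le {φ : RatFunc ℂ} (hd : 1 ≤ degree φ) {s0 s1 s2 K : Finset (OnePoint ℂ)}
    {c0 c1 c2 : OnePoint ℂ} (h01 : c0 ≠ c1) (h02 : c0 ≠ c2) (h12 : c1 ≠ c2)
    (hs0 : ∀ x, x ∈ s0 ↔ toMap φ x = c0) (hs1 : ∀ x, x ∈ s1 ↔ toMap φ x = c1)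
    (hs2 : ∀ x, x ∈ s2 ↔ toMap φ x = c2) (e0 : ∑ x ∈ s0, ram φ x = degree φ)
    (e1 : ∑ x ∈ s1, ram φ x = degree φ) (e2 : ∑ x ∈ s2, ram φ x = degree φ)
    (hK : ∀ x ∈ K, 2 ≤ ram φ x ∧ toMap φ x ≠ c0 ∧ toMap φ x ≠ c1 ∧ toMap φ x ≠ c2) :
    degree φ + #K + 2 ≤ #s0 + #s1 + #s2 := by
  have d1 : Disjoint s0 s1 := disjoint_left.2 fun x hx hx' =>
    h01 (((hs0 x).1 hx).symm.trans ((hs1 x).1 hx'))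
  have d2 : Disjoint (s0 ∪ s1) s2 := disjoint_left.2 fun x hx hx' => by
    rw [mem_union, hs0, hs1] at hx
    rw [hs2] at hx'
    rcases hx with hx | hx
    · exact h02 (hx.symm.trans hx')
    · exact h12 (hx.symm.trans hx')
  have d3 : Disjoint (s0 ∪ s1 ∪ s2) K := disjoint_left.2 fun x hx hx' => by
    obtain ⟨-, k0, k1, k2⟩ := hK x hx'
    rw [mem_union, mem_union, hs0, hs1, hs2] at hx
    tauto
  have h := sum_ram_sub_one_le hd (s0 ∪ s1 ∪ s2 ∪ K)
  rw [sum_union d3, sum_union d2, sum_union d1] at h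
  have hsub : ∀ s : Finset (OnePoint ℂ), ∑ x ∈ s, (ram φ x - 1) + #s = ∑ x ∈ s, ram φ x := by
    intro s
    rw [card_eq_sum_ones, ← sum_add_distrib]
    exact sum_congr rfl fun x _ => Nat.sub_add_cancel (ram_pos hd x)
  have hKle : #K ≤ ∑ x ∈ K, (ram φ x - 1) := by
    rw [card_eq_sum_ones]
    refine sum_le_sum fun x hx => ?_
    have := (hK x hx).1
    omega
  have := hsub s0
  have := hsub s1
  have := hsub s2
  omega

theorem sq_sub_four_mul (x y : ℂ) : (1 - x - y - 1) ^ 2 - 4 * (x * y) = (x - y) ^ 2 := by ring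

end Fuchs

/-! ### Assembly of the count -/

theorem mainTheorem9
    (S : Fuchs.RiemannScheme) (φ : RatFunc ℂ) (d : ℕ) (p0 p1 pinf : ℕ∞)
    (hd : Fuchs.degree φ = d) (hdpos : 1 ≤ d)
    (h0 : S.equation.order ((0 : ℂ) : OnePoint ℂ) = p0)
    (h1 : S.equation.order ((1 : ℂ) : OnePoint ℂ) = p1)
    (hinf : S.equation.order OnePoint.infty = pinf)
    (hp0 : p0 ≤ pinf) (hp1 : p1 ≤ pinf)
    (hyp : Fuchs.recip p0 + Fuchs.recip p1 + Fuchs.recip pinf < 1)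
    (hnonapp : {x : OnePoint ℂ |
      (S.equation.pullback (Fuchs.affineFun φ)).IsNonApparentSingularity x}.ncard = 6)
    (happ :
      {x : OnePoint ℂ | (S.equation.pullback (Fuchs.affineFun φ)).IsApparentSingularity x ∧
        Fuchs.toMap φ x ∉ Fuchs.poles}.ncard = 3 ∨
      (S.HasReciprocalExponents p0 p1 pinf ∧
        {x : OnePoint ℂ |
          (S.equation.pullback (Fuchs.affineFun φ)).IsApparentSingularity x}.ncard = 3)) :
    ((d : ℤ) - (⌊(d : ℝ) * Fuchs.recip p0⌋ + ⌊(d : ℝ) * Fuchs.recip p1⌋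
        + ⌊(d : ℝ) * Fuchs.recip pinf⌋) = 1) ∧
    ((1 - Fuchs.recip p0 - Fuchs.recip p1 - Fuchs.recip pinf) * (d : ℝ)
        ≤ 1 - 6 * Fuchs.recip pinf) ∧
    ((d : ℕ∞) < pinf → 1 ≤ 1 / (d : ℝ) + Fuchs.recip p0 + Fuchs.recip p1) ∧
    (pinf ≤ (d : ℕ∞) →
      (1 - Fuchs.recip p0 - Fuchs.recip p1) * (pinf.toNat : ℝ) ^ 2
          - 2 * (pinf.toNat : ℝ) + 6 ≤ 0 ∧
      5 / 6 ≤ Fuchs.recip p0 + Fuchs.recip p1 ∧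
      Fuchs.recip p0 + Fuchs.recip p1 < 1) := by
  classical
  have hdeg : 1 ≤ Fuchs.degree φ := hd ▸ hdpos
  set E' := S.equation.pullback (Fuchs.affineFun φ) with hE'
  have r0 := Fuchs.recip_nonneg p0
  have r1 := Fuchs.recip_nonneg p1
  have r2 := Fuchs.recip_nonneg pinf
  have hpole : ∀ x, Fuchs.toMap φ x ∉ Fuchs.poles ↔ Fuchs.toMap φ x ≠ ((0 : ℂ) : OnePoint ℂ) ∧
      Fuchs.toMap φ x ≠ ((1 : ℂ) : OnePoint ℂ) ∧ Fuchs.toMap φ x ≠ OnePoint.infty := fun x => by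
    simp [Fuchs.poles]
  -- Both alternatives are treated together: `K` holds apparent singularities off the polar fibres
  -- and `M` selects those counted twice in them. In the first alternative `M` is empty, as nothing
  -- is known about the exponents.
  obtain ⟨M, K, hM, hK, hcard⟩ : ∃ (M : OnePoint ℂ → Prop) (K : Finset (OnePoint ℂ)),
      (∀ x, M x → E'.IsApparentSingularity x ∧ S.HasReciprocalExponents p0 p1 pinf) ∧
      (∀ x ∈ K, E'.IsApparentSingularity x ∧ Fuchs.toMap φ x ∉ Fuchs.poles) ∧
      ∀ s : Finset (OnePoint ℂ), (∀ x, Fuchs.toMap φ x ∈ Fuchs.poles → x ∈ s) →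
        3 ≤ K.card + (s.filter M).card := by
    rcases happ with happ | ⟨hrec, happ⟩
    · have hfin := Set.finite_of_ncard_pos (by rw [happ]; norm_num)
      refine ⟨fun _ => False, hfin.toFinset, fun x hx => hx.elim, fun x hx => by simpa using hx,
        fun s _ => ?_⟩
      rw [← Set.ncard_eq_toFinset_card _ hfin, happ]
      omega
    · have hfin := Set.finite_of_ncard_pos (by rw [happ]; norm_num)
      refine ⟨E'.IsApparentSingularity,
        hfin.toFinset.filter fun x => Fuchs.toMap φ x ∉ Fuchs.poles, fun x hx => ⟨hx, hrec⟩,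
        fun x hx => by simpa using hx, fun s hs => ?_⟩
      rw [← happ, Set.ncard_eq_toFinset_card _ hfin]
      refine le_trans (Finset.card_le_card fun x hx => ?_) (Finset.card_union_le _ _)
      have hx' : E'.IsApparentSingularity x := by simpa using hx
      by_cases hx2 : Fuchs.toMap φ x ∈ Fuchs.poles
      · simp [hs x hx2, hx']
      · simp [hx2, hx']
  obtain ⟨s0, hs0, e0, b0⟩ := Fuchs.exists_fibre_bound hdeg S.hasRegularForm_zero r2
    (by rw [h0]; exact Fuchs.recip_le_recip (h0 ▸ S.equation.one_le_order _) hp0)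
    (by rw [h0]; linarith) M (fun x hx => ⟨(hM x hx).1, fun n hn => by
      rw [Fuchs.sq_sub_four_mul]; exact (hM x hx).2.1 n (h0 ▸ hn)⟩)
  obtain ⟨s1, hs1, e1, b1⟩ := Fuchs.exists_fibre_bound hdeg S.hasRegularForm_one r2
    (by rw [h1]; exact Fuchs.recip_le_recip (h1 ▸ S.equation.one_le_order _) hp1)
    (by rw [h1]; linarith) M (fun x hx => ⟨(hM x hx).1, fun n hn => by
      rw [Fuchs.sq_sub_four_mul]; exact (hM x hx).2.2.1 n (h1 ▸ hn)⟩)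
  obtain ⟨s2, hs2, e2, b2⟩ := Fuchs.exists_fibre_bound hdeg S.hasRegularForm_infty r2
    (by rw [hinf])
    (by rw [hinf]; linarith) M (fun x hx => ⟨(hM x hx).1, fun n hn => by
      rw [Fuchs.sq_sub_four_mul]; exact (hM x hx).2.2.2 n (hinf ▸ hn)⟩)
  rw [← hE', hd, h0] at b0
  rw [← hE', hd, h1] at b1
  rw [← hE', hd, hinf] at b2
  have hRH := Fuchs.degree_add_card_le (K := K) hdeg (by simp) (OnePoint.coe_ne_infty _)
    (OnePoint.coe_ne_infty _) hs0 hs1 hs2 e0 e1 e2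
    fun x hx => ⟨Fuchs.LinearODE.two_le_ram hdeg S (hK x hx).2 (hK x hx).1.1,
      (hpole x).1 (hK x hx).2⟩
  have hKM : 3 ≤ K.card + ((s0.filter M).card + (s1.filter M).card + (s2.filter M).card) := by
    have h3 := hcard (s0 ∪ s1 ∪ s2) fun x hx => by
      rw [Finset.mem_union, Finset.mem_union, hs0, hs1, hs2]
      by_contra hne
      rw [not_or, not_or] at hne
      exact (hpole x).2 ⟨hne.1.1, hne.1.2, hne.2⟩ hx
    rw [Finset.filter_union, Finset.filter_union] at h3
    have h4 := Finset.card_union_le (s0.filter M ∪ s1.filter M) (s2.filter M)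
    have h5 := Finset.card_union_le (s0.filter M) (s1.filter M)
    omega
  have hbad : (s0.filter fun x => ¬ E'.order x = 1).card + (s1.filter fun x => ¬ E'.order x = 1).card
      + (s2.filter fun x => ¬ E'.order x = 1).card ≤ 6 := by
    have hfin := Set.finite_of_ncard_pos (s := {x | E'.IsNonApparentSingularity x})
      (by rw [hnonapp]; norm_num)
    rw [← Finset.card_union_of_disjoint, ← Finset.card_union_of_disjoint, ← hnonapp,
      Set.ncard_eq_toFinset_card _ hfin]
    · refine Finset.card_le_card fun x hx => ?_
      have : ¬ E'.order x = 1 := by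
        simp only [Finset.mem_union, Finset.mem_filter] at hx
        tauto
      exact (Set.Finite.mem_toFinset _).2 this
    · refine Finset.disjoint_left.2 fun x hx hx' => ?_
      simp only [Finset.mem_union, Finset.mem_filter, hs0, hs1, hs2] at hx hx'
      rcases hx with hx | hx
      · exact OnePoint.coe_ne_infty _ (hx.1.symm.trans hx'.1)
      · exact OnePoint.coe_ne_infty _ (hx.1.symm.trans hx'.1)
    · refine Finset.disjoint_left.2 fun x hx hx' => ?_
      simp only [Finset.mem_filter, hs0, hs1] at hx hx'
      have := hx.1.symm.trans hx'.1
      simp at this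
  have c0 := Finset.card_filter_add_card_filter_not (s := s0) (fun x => E'.order x = 1)
  have c1 := Finset.card_filter_add_card_filter_not (s := s1) (fun x => E'.order x = 1)
  have c2 := Finset.card_filter_add_card_filter_not (s := s2) (fun x => E'.order x = 1)
  rw [hd] at hRH
  -- The remaining `d + 5` is the `d + 2` of Riemann–Hurwitz plus the three apparent singularities,
  -- shared between `K` and `M`.
  exact Fuchs.arithmetic_of_fibre_bounds hyp (hinf ▸ S.equation.one_le_order _) hdpos b0 b1 b2 hbad
    (by omega)
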